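/- Let $G$ be a finite abelian group and $R=\mathbb{Z}[G]$. Let $\mathcal{P}$ be the class of $R$-modules of finite length and of projective dimension at most $1$ over $R$. For a finitely generated $R$-module $M$, $\mathrm{Fitt}_R(M)$ denotes its initial Fitting ideal. For an $R$-module $X$ of finite length put \[ \mathrm{SFitt}^1_R(X)=\mathrm{Fitt}_R(P)^{-1}\,\mathrm{Fitt}_R(Y),\qquad \mathrm{SFitt}^{\langle -1\rangle}_R(X)=\mathrm{Fitt}_R(P')^{-1}\,\mathrm{Fitt}_R(Y'), \] where $0\to Y\to P\to X\to 0$ and $0\to X\to P'\to Y'\to 0$ are exact sequences of $R$-modules of finite length with $P,P'\in\mathcal{P}$; these are fractional ideals of $R$ in $\mathbb{Q}[G]$. Let $I\subset D\subset G$ be subgroups such that $D/I$ is cyclic, and let $\varphi$ be a generator of $D/I$. Put \[ g=1-\varphi^{-1}+\# I\in\mathbb{Z}[G/I],\qquad A=\mathbb{Z}[G/I]/(g),\qquad \nu_I=\sum_{\tau\in I}\tau\in\mathbb{Z}[G]. \] Then $g$ is invertible in $\mathbb{Q}[G/I]$, and for $X=A$ exact sequences as above exist and the two fractional ideals above do not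 depend on their choice. Moreover, \[ \mathrm{SFitt}^1_{\mathbb{Z}[G]}(A)\subset \mathrm{SFitt}^{\langle -1\rangle}_{\mathbb{Z}[G]}(A)=\left(1,\ \nu_I g^{-1}\right), \] where the right-hand side is the $\mathbb{Z}[G]$-submodule of $\mathbb{Q}[G]$ generated by $1$ and $\nu_I g^{-1}$, and $\nu_I g^{-1}$ denotes the product of $\nu_I$ with any lift of $g^{-1}\in\mathbb{Q}[G/I]$ to $\mathbb{Q}[G]$. If $I$ is cyclic, the inclusion is an equality. -/

import Mathlib

open scoped AlgebraMonoidAlgebra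

universe u

noncomputable section

namespace ShiftedFitting

/-! ### Fitting ideals -/

section Fitting

variable (R : Type u) [CommRing R]

/-- The matrix `B` with `m` rows and `n` columns is a presentation of `X`: there is an exact
sequence `R^m → R^n → X → 0`, where the first map multiplies row vectors by `B` from the right. -/
def IsPresentation {m n : ℕ} (B : Matrix (Fin m) (Fin n) R)
    (X : Type u) [AddCommGroup X] [Module R X] : Prop :=
  ∃ p : (Fin n → R) →ₗ[R] X, Function.Surjective p ∧ Function.Exact B.vecMulLinear p

/-- The `i`-th Fitting ideal of a matrix with `n` columns: the ideal generated by its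
`(n - i) × (n - i)` minors. Repeated or permuted rows and columns only contribute `0` or
a minor up to sign. For `i ≥ n` the only minor is the empty determinant `1`. -/
def matrixFittingIdeal (i : ℕ) {m n : ℕ} (B : Matrix (Fin m) (Fin n) R) : Ideal R :=
  Ideal.span {x | ∃ (a : Fin (n - i) → Fin m) (b : Fin (n - i) → Fin n),
    x = (B.submatrix a b).det}

/-- `F` is the `i`-th Fitting ideal of `X`, computed from some finite presentation of `X`. -/
def IsFittingIdeal (i : ℕ) (X : Type u) [AddCommGroup X] [Module R X] (F : Ideal R) : Prop :=
  ∃ (m n : ℕ) (B : Matrix (Fin m) (Fin n) R),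
    IsPresentation R B X ∧ F = matrixFittingIdeal R i B

/-- The `i`-th Fitting ideal of a finitely presented module `X`: the `i`-th Fitting ideal of a
chosen finite presentation. -/
def fittingIdeal (i : ℕ) (X : Type u) [AddCommGroup X] [Module R X] : Ideal R :=
  Classical.epsilon (IsFittingIdeal R i X)

end Fitting

/-! ### Shifts of Fitting ideals -/

section Shift

variable (R : Type u) [CommRing R]

/-- An exact sequence `0 → M 0 → M 1 → ⋯ → M d → M (d + 1) → 0` of `R`-modules of finite length
such that `M 1, …, M d` have projective dimension at most one.
(The modules `M i` and the maps with larger index play no role.) -/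
structure Resolution (d : ℕ) where
  /-- the modules of the sequence -/
  M : ℕ → ModuleCat.{u} R
  /-- the maps of the sequence -/
  f : ∀ i, M i →ₗ[R] M (i + 1)
  injective : Function.Injective (f 0)
  surjective : Function.Surjective (f d)
  exact : ∀ i < d, Function.Exact (f i) (f (i + 1))
  isFiniteLength : ∀ i ≤ d + 1, IsFiniteLength R (M i)
  projectiveDimension_le : ∀ i ∈ Finset.Icc 1 d,
    CategoryTheory.HasProjectiveDimensionLE (M i) 1

variable (Q : Type u) [CommRing Q] [Algebra R Q]

/-- The initial Fitting ideal of `X`, viewed as an `R`-submodule of the total ring of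
fractions `Q` of `R`. -/
def fracFitting (X : Type u) [AddCommGroup X] [Module R X] : Submodule R Q :=
  IsLocalization.coeSubmodule Q (fittingIdeal R 0 X)

/-- The fractional ideal `∏_{i = 1}^{d} Fitt_R (M i) ^ ((-1) ^ i)`. The inverse of an invertible
fractional ideal `J` is `1 / J = {x ∈ Q | x J ⊆ R}`. -/
def Resolution.altProd {R : Type u} [CommRing R] {d : ℕ} (S : Resolution R d)
    (Q : Type u) [CommRing Q] [Algebra R Q] : Submodule R Q :=
  ∏ i ∈ Finset.Icc 1 d,
    if Even i then fracFitting R Q (S.M i) else 1 / fracFitting R Q (S.M i)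

/-- `J = (∏_{i = 1}^{d} Fitt_R (P_i) ^ ((-1) ^ i)) Fitt_R (Y)` for some exact sequence
`0 → Y → P_1 → ⋯ → P_d → X → 0` as above. -/
def IsSFitt (d : ℕ) (X : Type u) [AddCommGroup X] [Module R X] (J : Submodule R Q) : Prop :=
  ∃ S : Resolution R d, Nonempty (X ≃ₗ[R] S.M (d + 1)) ∧
    J = S.altProd Q * fracFitting R Q (S.M 0)

/-- `J = (∏_{i = 1}^{d} Fitt_R (P_i) ^ ((-1) ^ i)) Fitt_R (Y)` for some exact sequence
`0 → X → P_1 → ⋯ → P_d → Y → 0` as above. -/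
def IsSFittNeg (d : ℕ) (X : Type u) [AddCommGroup X] [Module R X] (J : Submodule R Q) : Prop :=
  ∃ S : Resolution R d, Nonempty (X ≃ₗ[R] S.M 0) ∧
    J = S.altProd Q * fracFitting R Q (S.M (d + 1))

/-- The `d`-th shift `SFitt^d_R(X)` of the Fitting ideal, from a chosen exact sequence. -/
def SFitt (d : ℕ) (X : Type u) [AddCommGroup X] [Module R X] : Submodule R Q :=
  Classical.epsilon (IsSFitt R Q d X)

/-- The negative shift `SFitt^{⟨-d⟩}_R(X)` of the Fitting ideal, from a chosen exact sequence. -/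
def SFittNeg (d : ℕ) (X : Type u) [AddCommGroup X] [Module R X] : Submodule R Q :=
  Classical.epsilon (IsSFittNeg R Q d X)

end Shift

/-! ### The module `A = ℤ[G/I] / (g)` and the element `ν_I g⁻¹` -/

section Setting

variable {G : Type u} [CommGroup G] [Finite G] (I : Subgroup G)

/-- `g = 1 - φ⁻¹ + #I ∈ ℤ[G/I]`. -/
def gElt (φ : G ⧸ I) : MonoidAlgebra ℤ (G ⧸ I) :=
  1 - MonoidAlgebra.single φ⁻¹ 1 + (Nat.card I : MonoidAlgebra ℤ (G ⧸ I))

/-- The additive group `A = ℤ[G/I] / (g)`. -/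
def A (φ : G ⧸ I) : Type u := MonoidAlgebra ℤ (G ⧸ I) ⧸ Ideal.span {gElt I φ}

instance (φ : G ⧸ I) : AddCommGroup (A I φ) :=
  inferInstanceAs (AddCommGroup (MonoidAlgebra ℤ (G ⧸ I) ⧸ Ideal.span {gElt I φ}))

/-- `A` is a `ℤ[G]`-module through the natural projection `ℤ[G] → ℤ[G/I]`. -/
instance (φ : G ⧸ I) : Module (MonoidAlgebra ℤ G) (A I φ) :=
  Module.compHom (MonoidAlgebra ℤ (G ⧸ I) ⧸ Ideal.span {gElt I φ})
    (MonoidAlgebra.mapDomainRingHom ℤ (QuotientGroup.mk' I))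

/-- The norm element `ν_I = ∑_{τ ∈ I} τ ∈ ℚ[G]`. -/
def normElt : MonoidAlgebra ℚ G := ∑ᶠ τ : I, MonoidAlgebra.single (τ : G) 1

/-- For `x ∈ ℚ[G/I]`, the product `ν_I x ∈ ℚ[G]`: the coset `σI` is sent to `∑_{τ ∈ σI} τ`.
By `normMul_map`, it is `ν_I y` for every lift `y ∈ ℚ[G]` of `x`. -/
def normMul (x : MonoidAlgebra ℚ (G ⧸ I)) : MonoidAlgebra ℚ G :=
  MonoidAlgebra.ofCoeff (Finsupp.equivFunOnFinite.symm fun σ : G => x.coeff (σ : G ⧸ I))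

theorem normMul_map (y : MonoidAlgebra ℚ G) :
    normMul I (MonoidAlgebra.mapDomainRingHom ℚ (QuotientGroup.mk' I) y) = normElt I * y := by
  classical
  have hadd : ∀ x z, normMul I (x + z) = normMul I x + normMul I z := by
    intro x z
    ext σ
    simp [normMul]
  induction y using MonoidAlgebra.induction_linear with
  | zero => ext σ; simp [normMul]
  | add f g hf hg => rw [map_add, hadd, hf, hg, mul_add]
  | single a r =>
    have : Fintype I := Fintype.ofFinite I
    ext σ
    rw [normElt, finsum_eq_sum_of_fintype, Finset.sum_mul]
    simp only [normMul, MonoidAlgebra.mapDomainRingHom_apply, MonoidAlgebra.mapDomain_single,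
      MonoidAlgebra.single_mul_single, one_mul, MonoidAlgebra.coeff_sum,
      MonoidAlgebra.coeff_single, Finsupp.equivFunOnFinite_symm_apply_apply,
      Finsupp.finsetSum_apply, Finsupp.single_apply]
    have key : ∀ τ : I, ((τ : G) * a = σ) ↔ (τ : G) = σ * a⁻¹ := fun τ => eq_mul_inv_iff_mul_eq.symm
    simp only [key]
    by_cases h : σ * a⁻¹ ∈ I
    · have h1 : (QuotientGroup.mk' I) a = (σ : G ⧸ I) := by
        rw [QuotientGroup.mk'_apply, QuotientGroup.eq, mul_comm]
        exact h
      rw [if_pos h1, Finset.sum_eq_single ⟨σ * a⁻¹, h⟩]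
      · simp
      · intro b _ hb
        rw [if_neg]
        intro h2
        exact hb (Subtype.ext h2)
      · simp
    · have h1 : ¬ (QuotientGroup.mk' I) a = (σ : G ⧸ I) := by
        rw [QuotientGroup.mk'_apply, QuotientGroup.eq, mul_comm]
        exact h
      rw [if_neg h1, Finset.sum_eq_zero]
      intro b _
      rw [if_neg]
      intro h2
      exact h (h2 ▸ b.2)

end Setting

end ShiftedFitting

end

/-!
Write `R = ℤ[G]`. The initial Fitting ideal of a module presented by a surjection `p : R^n → X` is
the ideal generated by all determinants with rows in `ker p` (`detIdeal`,
`fittingIdeal_eq_detIdeal`), and its formal properties come from the multilinear expansion of such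
determinants (`detIdeal_le_mul`).

*The shifts are well defined.* For a finite module `P` of projective dimension at most one, write
`P = F / K` with `F` free and `K` projective, and let `c` be a nonzero integer annihilating `P`.
If `K ⊕ L` is free, then `P ⊕ K / cF` has a presentation by a square matrix
(`IsPerfectTorsion.exists_hasSquarePresentation`). Hence `Fitt(P)` is invertible, and `Fitt(Z) =
Fitt(Y) Fitt(P)` for every exact sequence `0 → Y → Z → P → 0`
(`IsPerfectTorsion.fracFitting_eq_mul`); no localization is involved. Two sequences `0 → Y → P → X
→ 0` are compared through a fibre product. For two sequences `0 → X → P → Y → 0`, both middle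
terms embed, with cokernels of the same kind, into finite free modules over `R / (c)`
(`IsPerfectTorsion.exists_embedding`); this ring is injective over itself
(`hasExtensionProperty_natCast`), and so Schanuel's lemma applies.

*The computation.* Lift `φ` to `σ ∈ G`, and `g` to `g̃ = 1 - σ⁻¹ + #I` in `R`; it divides the
nonzero integer `(1 + #I)^n - 1`, where `n` is the order of `σ`, so that `R / (g̃)` is finite of
projective dimension at most one. Multiplication by `ν_I` gives `0 → A → R / (g̃) → R / (g̃, ν_I)
→ 0`, whence `SFitt^{⟨-1⟩}(A) = (1, ν_I g⁻¹)`. On the other side, the kernel of `R / (g̃) → A` is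
`𝔞 / g̃𝔞`, where `𝔞` is generated by the `τ - 1` for `τ ∈ I`. Its Fitting ideal is contained in
`(g̃) + Fitt(𝔞)`, and `Fitt(𝔞)` annihilates `𝔞`, so that it lies in `(ν_I)`; this is the
inclusion. If `I` is generated by `τ`, multiplication by `τ - 1` identifies `R / (g̃, ν_I)` with
`𝔞 / g̃𝔞`, and equality holds.
-/

namespace ShiftedFitting

open scoped MonoidAlgebra

/-! ### Ideals generated by determinants -/

section DetIdeal

variable {R : Type*} [CommRing R]

/-- The ideal generated by the determinants of the square matrices all of whose rows lie in a
given submodule `S` of a free module. For `S` the kernel of a surjection `R^ι → X` this is the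
initial Fitting ideal of `X`; no finite generation of `S` is needed. -/
def detIdeal {ι : Type*} [Fintype ι] [DecidableEq ι] (S : Submodule R (ι → R)) : Ideal R :=
  Ideal.span {d | ∃ M : Matrix ι ι R, (∀ i, M i ∈ S) ∧ d = M.det}

variable {ι κ : Type*} [Fintype ι] [DecidableEq ι] [Fintype κ] [DecidableEq κ]

theorem det_mem_detIdeal {S : Submodule R (ι → R)} {M : Matrix ι ι R} (h : ∀ i, M i ∈ S) :
    M.det ∈ detIdeal S :=
  Ideal.subset_span ⟨M, h, rfl⟩

/-- Multilinear expansion of a determinant: to see that it lies in an ideal one may replace each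
row by the members of a set spanning it. -/
theorem det_mem_of_forall_mem_span (J : Ideal R) (T : ι → Set (ι → R)) (s : Finset ι)
    (hT : ∀ M : Matrix ι ι R, (∀ i, M i ∈ T i) → M.det ∈ J)
    (M : Matrix ι ι R) (hM : ∀ i ∈ s, M i ∈ Submodule.span R (T i))
    (hM' : ∀ i ∉ s, M i ∈ T i) : M.det ∈ J := by
  induction s using Finset.induction_on generalizing M with
  | empty => exact hT M fun i => hM' i (by simp)
  | insert a s ha ih =>
    have key : ∀ x ∈ Submodule.span R (T a), (M.updateRow a x).det ∈ J := by
      intro x hx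
      induction hx using Submodule.span_induction with
      | mem x hx =>
        refine ih _ (fun i hi => ?_) fun i hi => ?_
        · have : i ≠ a := fun h => ha (h ▸ hi)
          rw [Matrix.updateRow_ne this]
          exact hM i (Finset.mem_insert_of_mem hi)
        · by_cases h : i = a
          · subst h; simpa using hx
          · rw [Matrix.updateRow_ne h]
            exact hM' i (by simp [h, hi])
      | zero => rw [Matrix.det_eq_zero_of_row_eq_zero a (by simp)]; exact J.zero_mem
      | add x y _ _ hx hy => rw [Matrix.det_updateRow_add]; exact J.add_mem hx hy
      | smul c x _ hx => rw [Matrix.det_updateRow_smul]; exact J.mul_mem_left _ hx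
    simpa using key (M a) (hM a (Finset.mem_insert_self _ _))

/-- A determinant vanishes if more than `#κ` of its rows lie in the span of `#κ` vectors. -/
theorem det_eq_zero_of_card_lt {κ : Type*} [Fintype κ] (v : κ → ι → R) (s : Finset ι)
    (hs : Fintype.card κ < s.card)
    (M : Matrix ι ι R) (hM : ∀ i ∈ s, M i ∈ Submodule.span R (Set.range v)) : M.det = 0 := by
  classical
  rw [← Ideal.mem_bot]
  refine det_mem_of_forall_mem_span ⊥ (fun i => if i ∈ s then Set.range v else {M i}) s
    (fun M' hM' => ?_) M (fun i hi => by simpa [hi] using hM i hi) fun i hi => by simp [hi]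
  have h1 : ∀ i : s, ∃ k, v k = M' i := fun i => by simpa [i.2] using hM' i
  choose f hf using h1
  obtain ⟨x, y, hxy, hfxy⟩ := Fintype.exists_ne_map_eq_of_card_lt f (by simpa using hs)
  rw [Ideal.mem_bot]
  refine Matrix.det_zero_of_row_eq (i := (x : ι)) (j := (y : ι)) (fun h => hxy (Subtype.ext h)) ?_
  rw [← hf, ← hf, hfxy]

/-- The expansion behind the multiplicativity of Fitting ideals. Suppose `S ⊆ R^ι × R^κ` is
spanned by vectors `(a, 0)` with `a ∈ S₁` and by a set `B` of vectors whose second component lies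
in `S₂`. If `B` lies in the span of only `#κ` vectors, then a determinant with rows in `S` is a
combination of block triangular ones. -/
theorem detIdeal_le_mul {S : Submodule R (ι ⊕ κ → R)} {S₁ : Submodule R (ι → R)}
    {S₂ : Submodule R (κ → R)} (B : Set (ι ⊕ κ → R)) (v : κ → ι ⊕ κ → R)
    (hB : ∀ x ∈ B, x ∘ Sum.inr ∈ S₂) (hBv : B ⊆ Submodule.span R (Set.range v))
    (hS : S ≤ Submodule.span R ((fun a => Sum.elim a (0 : κ → R)) '' (S₁ : Set (ι → R)) ∪ B)) :
    detIdeal S ≤ detIdeal S₁ * detIdeal S₂ := by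
  classical
  refine Ideal.span_le.2 ?_
  rintro _ ⟨M, hM, rfl⟩
  refine det_mem_of_forall_mem_span _ (fun _ => _) Finset.univ (fun M hM => ?_) M
    (fun i _ => hS (hM i)) (by simp)
  -- `s` consists of the rows of the first kind; the other rows lie in `B`
  let s : Finset (ι ⊕ κ) := {i | M i ∈ (fun a => Sum.elim a (0 : κ → R)) '' (S₁ : Set (ι → R))}
  have hs : ∀ i ∈ s, ∃ a ∈ S₁, Sum.elim a 0 = M i := fun i hi => by simpa [s] using hi
  have hs' : ∀ i ∈ sᶜ, M i ∈ B := fun i hi => (hM i).resolve_left (by simpa [s] using hi)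
  have hcard : s.card + sᶜ.card = Fintype.card ι + Fintype.card κ := by
    rw [Finset.card_add_card_compl, Fintype.card_sum]
  by_cases h1 : Fintype.card ι < s.card
  · rw [det_eq_zero_of_card_lt (fun i : ι => Pi.single (Sum.inl i) 1) s h1 M]
    · exact Ideal.zero_mem _
    · intro i hi
      obtain ⟨a, -, ha⟩ := hs i hi
      rw [← ha, Submodule.mem_span_range_iff_exists_fun]
      refine ⟨a, ?_⟩
      ext (j | j) <;> simp [Finset.sum_apply, Pi.single_apply]
  by_cases h2 : Fintype.card κ < sᶜ.card
  · rw [det_eq_zero_of_card_lt v sᶜ h2 M fun i hi => hBv (hs' i hi)]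
    exact Ideal.zero_mem _
  have e1 : Fintype.card ι = Fintype.card s := by simp; omega
  have e2 : Fintype.card κ = Fintype.card {i // i ∉ s} := by
    rw [Fintype.card_subtype_compl, Fintype.card_sum]; simp; omega
  let e : ι ⊕ κ ≃ ι ⊕ κ :=
    ((Fintype.equivOfCardEq e1).sumCongr (Fintype.equivOfCardEq e2)).trans (Equiv.sumCompl (· ∈ s))
  have he1 : ∀ i, e (Sum.inl i) ∈ s := fun i => by simp [e]
  have he2 : ∀ i, e (Sum.inr i) ∈ sᶜ := fun i => by
    simpa [e] using ((Fintype.equivOfCardEq e2) i).2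
  have hdet : (M.submatrix e id).det = (Equiv.Perm.sign e : ℤ) * M.det := Matrix.det_permute e M
  have hmem : (M.submatrix e id).det ∈ detIdeal S₁ * detIdeal S₂ := by
    rw [← Matrix.fromBlocks_toBlocks (M.submatrix e id)]
    have h12 : (M.submatrix e id).toBlocks₁₂ = 0 := by
      ext i j
      obtain ⟨a, -, ha⟩ := hs _ (he1 i)
      simp [Matrix.toBlocks₁₂, ← ha]
    rw [h12, Matrix.det_fromBlocks_zero₁₂]
    refine Ideal.mul_mem_mul (det_mem_detIdeal fun i => ?_) (det_mem_detIdeal fun i => ?_)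
    · obtain ⟨a, haS, ha⟩ := hs _ (he1 i)
      convert haS using 1
      ext j
      simp [Matrix.toBlocks₁₁, ← ha]
    · exact hB _ (hs' _ (he2 i))
  have : M.det = (Equiv.Perm.sign e : ℤ) * (M.submatrix e id).det := by
    rw [hdet, ← mul_assoc, ← Int.cast_mul, ← Units.val_mul, Int.units_mul_self]; simp
  rw [this]
  exact Ideal.mul_mem_left _ _ hmem

theorem mul_le_detIdeal {S : Submodule R (ι ⊕ κ → R)} {S₁ : Submodule R (ι → R)}
    {S₂ : Submodule R (κ → R)} (h₁ : ∀ a ∈ S₁, Sum.elim a 0 ∈ S)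
    (h₂ : ∀ b ∈ S₂, ∃ a, Sum.elim a b ∈ S) : detIdeal S₁ * detIdeal S₂ ≤ detIdeal S := by
  rw [detIdeal, detIdeal, Ideal.span_mul_span', Ideal.span_le]
  rintro _ ⟨_, ⟨M, hM, rfl⟩, _, ⟨N, hN, rfl⟩, rfl⟩
  choose a ha using fun i => h₂ (N i) (hN i)
  have : M.det * N.det = (Matrix.fromBlocks M 0 (Matrix.of a) N).det :=
    (Matrix.det_fromBlocks_zero₁₂ _ _ _).symm
  simp only [SetLike.mem_coe]
  rw [this]
  refine det_mem_detIdeal ?_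
  rintro (i | i)
  · convert h₁ _ (hM i) using 1
    ext (j | j) <;> simp
  · convert ha i using 1
    ext (j | j) <;> simp

theorem detIdeal_reindex (e : ι ≃ κ) (S : Submodule R (ι → R)) :
    detIdeal (S.comap (LinearMap.funLeft R R e)) = detIdeal S := by
  unfold detIdeal
  congr 1
  ext d
  constructor
  · rintro ⟨M, hM, rfl⟩
    exact ⟨M.submatrix e e, fun i => hM (e i), (Matrix.det_submatrix_equiv_self e M).symm⟩
  · rintro ⟨M, hM, rfl⟩
    refine ⟨M.submatrix e.symm e.symm, fun i => ?_,
      (Matrix.det_submatrix_equiv_self e.symm M).symm⟩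
    rw [Submodule.mem_comap]
    convert hM (e.symm i) using 1
    ext j
    simp [LinearMap.funLeft_apply]

theorem detIdeal_top : detIdeal (⊤ : Submodule R (ι → R)) = ⊤ := by
  rw [Ideal.eq_top_iff_one, ← Matrix.det_one (n := ι)]
  exact det_mem_detIdeal fun _ => trivial

/-- For a square presentation matrix, the ideal is principal. -/
theorem detIdeal_range (T : (ι → R) →ₗ[R] (ι → R)) :
    detIdeal (LinearMap.range T) = Ideal.span {LinearMap.det T} := by
  refine le_antisymm (Ideal.span_le.2 ?_) ((Ideal.span_singleton_le_iff_mem _).2 ?_)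
  · rintro _ ⟨M, hM, rfl⟩
    choose N hN using hM
    have : M = Matrix.of N * (LinearMap.toMatrix' T).transpose := by
      ext i j
      rw [← hN i, ← LinearMap.toMatrix'_mulVec T (N i)]
      simp [Matrix.mul_apply, Matrix.mulVec, dotProduct, mul_comm]
    rw [this, Matrix.det_mul, Matrix.det_transpose, LinearMap.det_toMatrix']
    exact Ideal.mul_mem_left _ _ (Ideal.mem_span_singleton_self _)
  · rw [← LinearMap.det_toMatrix', ← Matrix.det_transpose]
    refine det_mem_detIdeal fun i => ⟨Pi.single i 1, ?_⟩
    ext j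
    simp [LinearMap.toMatrix'_apply]

end DetIdeal

/-! ### Fitting ideals of modules -/

section Presentations

variable {R : Type*} [CommRing R] {ι κ : Type*} {X Y Z V : Type*} [AddCommGroup X] [Module R X] [AddCommGroup Y] [Module R Y]
  [AddCommGroup Z] [Module R Z] [AddCommGroup V] [Module R V]

/-- The map `R^ι × R^κ → Z` with components `p` and `q`. -/
def sumHom (p : (ι → R) →ₗ[R] Z) (q : (κ → R) →ₗ[R] Z) : (ι ⊕ κ → R) →ₗ[R] Z :=
  p ∘ₗ LinearMap.funLeft R R Sum.inl + q ∘ₗ LinearMap.funLeft R R Sum.inr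

theorem sumHom_apply (p : (ι → R) →ₗ[R] Z) (q : (κ → R) →ₗ[R] Z) (x : ι ⊕ κ → R) :
    sumHom p q x = p (x ∘ Sum.inl) + q (x ∘ Sum.inr) := rfl

@[simp]
theorem sumHom_elim (p : (ι → R) →ₗ[R] Z) (q : (κ → R) →ₗ[R] Z) (a : ι → R) (b : κ → R) :
    sumHom p q (Sum.elim a b) = p a + q b := rfl

theorem sumHom_surjective {p : (ι → R) →ₗ[R] Y} (hp : Function.Surjective p)
    {q : (κ → R) →ₗ[R] V} (hq : Function.Surjective q) {i : Y →ₗ[R] Z} {π : Z →ₗ[R] V}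
    (hex : Function.Exact i π) {h : (κ → R) →ₗ[R] Z} (hh : ∀ b, π (h b) = q b) :
    Function.Surjective (sumHom (i ∘ₗ p) h) := by
  intro z
  obtain ⟨b, hb⟩ := hq (π z)
  obtain ⟨y, hy⟩ := (hex (z - h b)).1 (by rw [map_sub, hh, hb, sub_self])
  obtain ⟨a, rfl⟩ := hp y
  exact ⟨Sum.elim a b, by simp [hy]⟩

variable [Fintype ι] [DecidableEq ι] [Fintype κ] [DecidableEq κ]

/-- Multiplicativity in an exact sequence `0 → Y → Z → V`, where `V` (or a submodule of it) has a
square presentation `T`: the presentations `p` of `Y` and `q` of `V` combine to one of `Z`. -/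
theorem detIdeal_ker_sumHom {p : (ι → R) →ₗ[R] Y} (hp : Function.Surjective p)
    {q : (κ → R) →ₗ[R] V} {i : Y →ₗ[R] Z} {π : Z →ₗ[R] V} (hi : Function.Injective i)
    (hex : Function.Exact i π) {h : (κ → R) →ₗ[R] Z} (hh : ∀ b, π (h b) = q b)
    (T : (κ → R) →ₗ[R] (κ → R)) (hT : LinearMap.ker q = LinearMap.range T) :
    detIdeal (LinearMap.ker (sumHom (i ∘ₗ p) h)) =
      detIdeal (LinearMap.ker p) * detIdeal (LinearMap.ker q) := by
  have hlift : ∀ b, q b = 0 → ∃ a, Sum.elim a b ∈ LinearMap.ker (sumHom (i ∘ₗ p) h) := by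
    intro b hb
    obtain ⟨y, hy⟩ := (hex (h b)).1 (by rw [hh, hb])
    obtain ⟨a, ha⟩ := hp (-y)
    exact ⟨a, by simp [ha, hy]⟩
  refine le_antisymm ?_ (mul_le_detIdeal (fun a ha => ?_) fun b hb => hlift b hb)
  · have hTk : ∀ c, q (T c) = 0 := fun c => by
      rw [← LinearMap.mem_ker, hT]; exact ⟨c, rfl⟩
    choose α hα using fun k : κ => hlift (T (Pi.single k 1)) (hTk _)
    have hsum : ∀ c : κ → R, ∑ k, c k • T (Pi.single k 1) = T c := by
      intro c
      rw [← pi_eq_sum_univ' c |> congrArg T |>.symm, map_sum]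
      simp
    refine detIdeal_le_mul (Set.range fun k => Sum.elim (α k) (T (Pi.single k 1)))
      (fun k => Sum.elim (α k) (T (Pi.single k 1))) ?_ Submodule.subset_span ?_
    · rintro _ ⟨k, rfl⟩
      exact hTk _
    · intro x hab
      obtain ⟨a, b, rfl⟩ : ∃ a b, x = Sum.elim a b := ⟨_, _, (Sum.elim_comp_inl_inr x).symm⟩
      have hb : q b = 0 := by
        have h1 : i (p a) + h b = 0 := hab
        have := congrArg π h1
        rwa [map_add, hex.apply_apply_eq_zero, hh, zero_add, map_zero] at this
      obtain ⟨c, rfl⟩ : b ∈ LinearMap.range T := hT ▸ hb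
      rw [Submodule.span_union]
      have hB : ∑ k, c k • (Sum.elim (α k) (T (Pi.single k 1)) : ι ⊕ κ → R) ∈
          Submodule.span R (Set.range fun k => (Sum.elim (α k) (T (Pi.single k 1)))) :=
        Submodule.sum_mem _ fun k _ => Submodule.smul_mem _ _ (Submodule.subset_span ⟨k, rfl⟩)
      have hBker : ∑ k, c k • (Sum.elim (α k) (T (Pi.single k 1)) : ι ⊕ κ → R) ∈
          LinearMap.ker (sumHom (i ∘ₗ p) h) :=
        Submodule.sum_mem _ fun k _ => Submodule.smul_mem _ _ (hα k)
      have hBeq : ∑ k, c k • (Sum.elim (α k) (T (Pi.single k 1)) : ι ⊕ κ → R) =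
          Sum.elim (∑ k, c k • α k) (T c) := by
        rw [← hsum c]
        ext (j | j) <;> simp [Finset.sum_apply]
      rw [hBeq] at hB hBker
      have hdiff : (Sum.elim a (T c) : ι ⊕ κ → R) =
          Sum.elim (a - ∑ k, c k • α k) 0 + Sum.elim (∑ k, c k • α k) (T c) := by
        ext (j | j) <;> simp
      rw [hdiff]
      refine Submodule.add_mem_sup (Submodule.subset_span ⟨_, ?_, rfl⟩) hB
      have h2 := Submodule.sub_mem _ hab hBker
      have h3 : (Sum.elim a (T c) - Sum.elim (∑ k, c k • α k) (T c) : ι ⊕ κ → R) =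
          Sum.elim (a - ∑ k, c k • α k) 0 := by
        ext (j | j) <;> simp
      rw [h3, LinearMap.mem_ker, sumHom_elim, map_zero, add_zero] at h2
      exact hi (by simpa using h2)
  · have : p a = 0 := ha
    simp [this]

/-- The ideal attached to a presentation depends only on the presented module. -/
theorem detIdeal_ker_eq {p : (ι → R) →ₗ[R] X} (hp : Function.Surjective p)
    {q : (κ → R) →ₗ[R] X} (hq : Function.Surjective q) :
    detIdeal (LinearMap.ker p) = detIdeal (LinearMap.ker q) := by
  have h1 := detIdeal_ker_sumHom (Z := X) (V := PUnit) (q := (0 : (κ → R) →ₗ[R] PUnit)) hp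
    (i := LinearMap.id) (π := 0) (fun _ _ h => h) (fun x => by simp) (h := q) (fun _ => rfl)
    LinearMap.id (by simp)
  have h2 := detIdeal_ker_sumHom (Z := X) (V := PUnit) (q := (0 : (ι → R) →ₗ[R] PUnit)) hq
    (i := LinearMap.id) (π := 0) (fun _ _ h => h) (fun x => by simp) (h := p) (fun _ => rfl)
    LinearMap.id (by simp)
  rw [LinearMap.ker_zero, detIdeal_top, Ideal.mul_top, LinearMap.id_comp] at h1 h2
  rw [← h1, ← h2, ← detIdeal_reindex (Equiv.sumComm ι κ)]
  congr 1
  ext x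
  simp only [LinearMap.mem_ker, Submodule.mem_comap, sumHom_apply]
  rw [add_comm]
  rfl

theorem detIdeal_ker_prod (p : (ι → R) →ₗ[R] Y) (q : (κ → R) →ₗ[R] V) :
    detIdeal (LinearMap.ker (sumHom (LinearMap.inl R Y V ∘ₗ p) (LinearMap.inr R Y V ∘ₗ q))) =
      detIdeal (LinearMap.ker p) * detIdeal (LinearMap.ker q) := by
  refine le_antisymm ?_ (mul_le_detIdeal (fun a ha => ?_) fun b hb => ⟨0, ?_⟩)
  · refine detIdeal_le_mul ((fun b => Sum.elim (0 : ι → R) b) '' (LinearMap.ker q : Set (κ → R)))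
      (fun k => Pi.single (Sum.inr k) 1) ?_ ?_ ?_
    · rintro _ ⟨b, hb, rfl⟩
      exact hb
    · rintro _ ⟨b, hb, rfl⟩
      refine (Submodule.mem_span_range_iff_exists_fun R).2 ⟨b, ?_⟩
      ext (j | j) <;> simp [Finset.sum_apply, Pi.single_apply]
    · intro x hab
      obtain ⟨a, b, rfl⟩ : ∃ a b, x = Sum.elim a b := ⟨_, _, (Sum.elim_comp_inl_inr x).symm⟩
      have h0 : p a = 0 ∧ q b = 0 := by simpa [Prod.ext_iff] using hab
      have : (Sum.elim a b : ι ⊕ κ → R) = Sum.elim a (0 : κ → R) + Sum.elim (0 : ι → R) b := by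
        ext (j | j) <;> simp
      rw [this]
      exact Submodule.add_mem _ (Submodule.subset_span (Or.inl ⟨a, h0.1, rfl⟩))
        (Submodule.subset_span (Or.inr ⟨b, h0.2, rfl⟩))
  · have : p a = 0 := ha
    simp [this]
  · have : q b = 0 := hb
    simp [this]

end Presentations

section FittingIdeal

variable {R : Type u} [CommRing R]

theorem matrixFittingIdeal_zero {m n : ℕ} (B : Matrix (Fin m) (Fin n) R) :
    matrixFittingIdeal R 0 B = detIdeal (LinearMap.range B.vecMulLinear) := by
  refine le_antisymm (Ideal.span_le.2 ?_) (Ideal.span_le.2 ?_)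
  · rintro _ ⟨a, b, rfl⟩
    change Fin n → Fin n at b
    by_cases hb : Function.Injective b
    · let e : Equiv.Perm (Fin n) := Equiv.ofBijective b (Finite.injective_iff_bijective.1 hb)
      have : (B.submatrix a b).det = (Equiv.Perm.sign e : ℤ) * (B.submatrix a id).det :=
        Matrix.det_permute' e (B.submatrix a id)
      rw [this]
      refine Ideal.mul_mem_left _ _ (det_mem_detIdeal fun i => ⟨Pi.single (a i) 1, ?_⟩)
      ext j
      simp
    · obtain ⟨x, y, hxy, hne⟩ := by simpa [Function.Injective] using hb
      rw [Matrix.det_zero_of_column_eq hne fun i => by simp [hxy]]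
      exact Ideal.zero_mem _
  · rintro _ ⟨M, hM, rfl⟩
    refine det_mem_of_forall_mem_span _ (fun _ => Set.range B) Finset.univ (fun N hN => ?_) M
      (fun i _ => ?_) (by simp)
    · choose a ha using hN
      refine Ideal.subset_span ⟨a, id, ?_⟩
      congr 1
      ext i j
      simp [ha]
    · obtain ⟨c, hc⟩ := hM i
      refine (Submodule.mem_span_range_iff_exists_fun R).2 ⟨c, ?_⟩
      rw [← hc]
      ext j
      simp [Matrix.vecMul, dotProduct, Finset.sum_apply]

variable [IsNoetherianRing R] {X Y Z : Type u} [AddCommGroup X] [Module R X] [AddCommGroup Y]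
  [Module R Y] [AddCommGroup Z] [Module R Z]

theorem exists_isFittingIdeal [Module.Finite R X] : ∃ F, IsFittingIdeal R 0 X F := by
  obtain ⟨n, p, hp⟩ := Module.Finite.exists_fin' R X
  obtain ⟨m, q, hq⟩ := Module.Finite.exists_fin' R (LinearMap.ker p)
  let B : Matrix (Fin m) (Fin n) R := Matrix.of fun i => (q (Pi.single i 1) : Fin n → R)
  have hB : ∀ c, B.vecMulLinear c = q c := by
    intro c
    have : (LinearMap.ker p).subtype ∘ₗ q = B.vecMulLinear := by
      refine LinearMap.pi_ext' fun i => LinearMap.ext_ring ?_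
      ext j
      simp [B]
    rw [← this]
    rfl
  refine ⟨_, m, n, B, ⟨p, hp, fun x => ⟨fun hx => ?_, ?_⟩⟩, rfl⟩
  · obtain ⟨c, hc⟩ := hq ⟨x, hx⟩
    exact ⟨c, by rw [hB, hc]⟩
  · rintro ⟨c, rfl⟩
    rw [hB]
    exact (q c).2

/-- The Fitting ideal may be computed from any surjection from a finite free module. -/
theorem fittingIdeal_eq_detIdeal {ι : Type*} [Fintype ι] [DecidableEq ι]
    {p : (ι → R) →ₗ[R] X} (hp : Function.Surjective p) :
    fittingIdeal R 0 X = detIdeal (LinearMap.ker p) := by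
  have : Module.Finite R X := Module.Finite.of_surjective p hp
  obtain ⟨m, n, B, ⟨q, hq, hex⟩, hF⟩ :=
    Classical.epsilon_spec (exists_isFittingIdeal (R := R) (X := X))
  rw [fittingIdeal, hF, matrixFittingIdeal_zero, ← LinearMap.exact_iff.1 hex]
  exact detIdeal_ker_eq hq hp

theorem fittingIdeal_congr [Module.Finite R X] (e : X ≃ₗ[R] Y) :
    fittingIdeal R 0 X = fittingIdeal R 0 Y := by
  obtain ⟨n, p, hp⟩ := Module.Finite.exists_fin' R X
  rw [fittingIdeal_eq_detIdeal hp,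
    fittingIdeal_eq_detIdeal (p := e.toLinearMap ∘ₗ p) (e.surjective.comp hp)]
  congr 1
  ext x
  simp

theorem fittingIdeal_prod [Module.Finite R X] [Module.Finite R Y] :
    fittingIdeal R 0 (X × Y) = fittingIdeal R 0 X * fittingIdeal R 0 Y := by
  obtain ⟨n, p, hp⟩ := Module.Finite.exists_fin' R X
  obtain ⟨m, q, hq⟩ := Module.Finite.exists_fin' R Y
  rw [fittingIdeal_eq_detIdeal hp, fittingIdeal_eq_detIdeal hq, ← detIdeal_ker_prod,
    fittingIdeal_eq_detIdeal (sumHom_surjective hp hq (i := LinearMap.inl R X Y) (π := LinearMap.snd R X Y)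
      (h := LinearMap.inr R X Y ∘ₗ q) Function.Exact.inl_snd fun _ => rfl)]

theorem fittingIdeal_quotient (J : Ideal R) : fittingIdeal R 0 (R ⧸ J) = J := by
  have hp : Function.Surjective (J.mkQ ∘ₗ LinearMap.proj (R := R) (φ := fun _ : Unit => R) ()) :=
    J.mkQ_surjective.comp (LinearMap.proj_surjective _)
  rw [fittingIdeal_eq_detIdeal hp]
  have hker : ∀ x, x ∈ LinearMap.ker (J.mkQ ∘ₗ LinearMap.proj (R := R) (φ := fun _ : Unit => R) ())
      ↔ x () ∈ J := fun x => Submodule.Quotient.mk_eq_zero J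
  refine le_antisymm (Ideal.span_le.2 ?_) fun x hx => Ideal.subset_span ⟨fun _ _ => x, ?_, ?_⟩
  · rintro _ ⟨M, hM, rfl⟩
    rw [Matrix.det_unique]
    exact (hker _).1 (hM ())
  · exact fun _ => (hker fun _ => x).2 hx
  · exact (Matrix.det_unique (n := Unit) (fun _ _ => x)).symm

/-- `V` has a presentation with a square matrix. -/
def HasSquarePresentation (R : Type*) [CommRing R] (V : Type*) [AddCommGroup V] [Module R V] :
    Prop :=
  ∃ (n : ℕ) (q : (Fin n → R) →ₗ[R] V) (T : (Fin n → R) →ₗ[R] (Fin n → R)),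
    Function.Surjective q ∧ LinearMap.ker q = LinearMap.range T

theorem fittingIdeal_eq_mul_of_hasSquarePresentation [Module.Finite R Y]
    {V : Type u} [AddCommGroup V] [Module R V] (hV : HasSquarePresentation R V)
    {i : Y →ₗ[R] Z} {π : Z →ₗ[R] V} (hi : Function.Injective i)
    (hex : Function.Exact i π) (hπ : Function.Surjective π) :
    fittingIdeal R 0 Z = fittingIdeal R 0 Y * fittingIdeal R 0 V := by
  obtain ⟨n, p, hp⟩ := Module.Finite.exists_fin' R Y
  obtain ⟨m, q, T, hq, hT⟩ := hV
  obtain ⟨h, hh⟩ := Module.projective_lifting_property π q hπ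
  have hh' : ∀ b, π (h b) = q b := fun b => LinearMap.congr_fun hh b
  rw [fittingIdeal_eq_detIdeal hp, fittingIdeal_eq_detIdeal hq,
    ← detIdeal_ker_sumHom hp hi hex hh' T hT,
    fittingIdeal_eq_detIdeal (sumHom_surjective hp hq hex hh')]

/-- The Fitting ideal of a module with a square presentation is principal, and its generator
divides a power of every element annihilating the module. -/
theorem HasSquarePresentation.fittingIdeal_eq_span {V : Type u} [AddCommGroup V] [Module R V]
    (hV : HasSquarePresentation R V) {c : R} (hc : ∀ x : V, c • x = 0) :
    ∃ d, fittingIdeal R 0 V = Ideal.span {d} ∧ ∃ n : ℕ, d ∣ c ^ n := by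
  obtain ⟨n, q, T, hq, hT⟩ := hV
  refine ⟨LinearMap.det T, by rw [fittingIdeal_eq_detIdeal hq, hT, detIdeal_range], n, ?_⟩
  have h1 : ∀ j, ∃ a, T a = c • Pi.single j 1 := fun j => by
    have : c • Pi.single j 1 ∈ LinearMap.ker q := by simp [hc]
    rwa [hT] at this
  choose a ha using h1
  have h2 : T ∘ₗ (Pi.basisFun R (Fin n)).constr R a = c • LinearMap.id := by
    refine (Pi.basisFun R (Fin n)).ext fun j => ?_
    simp [ha]
  have h3 := congrArg LinearMap.det h2
  rw [LinearMap.det_comp, LinearMap.det_smul] at h3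
  nontriviality R
  rw [LinearMap.det_id, mul_one, Module.finrank_fin_fun] at h3
  exact ⟨_, h3.symm⟩

end FittingIdeal

/-! ### Torsion modules of projective dimension at most one -/

section Perfect

variable {R : Type u} [CommRing R]

/-- `P` is finitely generated, annihilated by `c`, and the kernel of some surjection from a finite
free module onto `P` is projective. -/
def IsPerfectTorsion (c : R) (P : Type u) [AddCommGroup P] [Module R P] : Prop :=
  ∃ (n : ℕ) (p : (Fin n → R) →ₗ[R] P), Function.Surjective p ∧
    Module.Projective R (LinearMap.ker p) ∧ ∀ x : P, c • x = 0

theorem IsPerfectTorsion.finite {c : R} {P : Type u} [AddCommGroup P] [Module R P]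
    (h : IsPerfectTorsion c P) : Module.Finite R P := by
  obtain ⟨n, p, hp, -⟩ := h
  exact Module.Finite.of_surjective p hp

open CategoryTheory in
theorem isPerfectTorsion_of_hasProjectiveDimensionLE {c : R} (P : ModuleCat.{u} R)
    [Module.Finite R P] [HasProjectiveDimensionLE P 1] (hc : ∀ x : P, c • x = 0) :
    IsPerfectTorsion c P := by
  obtain ⟨n, p, hp⟩ := Module.Finite.exists_fin' R P
  refine ⟨n, p, hp, ?_, hc⟩
  let S : ShortComplex (ModuleCat.{u} R) :=
    ShortComplex.mk (ModuleCat.ofHom (LinearMap.ker p).subtype) (ModuleCat.ofHom p)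
      (by ext x; exact x.2)
  have hS : S.ShortExact :=
    { exact := (ShortComplex.ShortExact.moduleCat_exact_iff_function_exact S).2 <| by
        intro x
        exact ⟨fun hx => ⟨⟨x, hx⟩, rfl⟩, fun ⟨y, hy⟩ => hy ▸ y.2⟩
      mono_f := (ModuleCat.mono_iff_injective _).2 (LinearMap.ker p).subtype_injective
      epi_g := (ModuleCat.epi_iff_surjective _).2 hp }
  have hproj : Projective S.X₂ := (IsProjective.iff_projective _).1 inferInstance
  have h1 := (hS.hasProjectiveDimensionLT_X₃_iff 0 hproj).1
    (inferInstanceAs (HasProjectiveDimensionLT P 2))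
  exact (IsProjective.iff_projective _).2 (projective_iff_hasProjectiveDimensionLT_one.2 h1)

theorem hasSquarePresentation_of_free {F : Type*} [AddCommGroup F] [Module R F] [Module.Free R F]
    [Module.Finite R F] {V : Type*} [AddCommGroup V] [Module R V] {q : F →ₗ[R] V}
    (hq : Function.Surjective q) {T : F →ₗ[R] F} (hT : LinearMap.ker q = LinearMap.range T) :
    HasSquarePresentation R V := by
  let b := (Module.Free.chooseBasis R F).reindex (Fintype.equivFin _)
  let e := b.equivFun
  refine ⟨_, q ∘ₗ e.symm.toLinearMap, e.toLinearMap ∘ₗ T ∘ₗ e.symm.toLinearMap,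
    hq.comp e.symm.surjective, ?_⟩
  ext x
  have h1 : e.symm x ∈ LinearMap.ker q ↔ e.symm x ∈ LinearMap.range T := by rw [hT]
  simp only [LinearMap.mem_ker, LinearMap.mem_range] at h1
  simp only [LinearMap.mem_ker, LinearMap.mem_range, LinearMap.comp_apply,
    LinearEquiv.coe_coe, h1]
  constructor
  · rintro ⟨y, hy⟩
    exact ⟨e y, by simp [hy]⟩
  · rintro ⟨y, hy⟩
    exact ⟨e.symm y, by rw [← hy]; simp⟩

theorem exists_comp_eq_of_ker_le {M N L : Type*} [AddCommGroup M] [Module R M] [AddCommGroup N]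
    [Module R N] [AddCommGroup L] [Module R L] {p : M →ₗ[R] N} (hp : Function.Surjective p)
    (g : M →ₗ[R] L) (h : LinearMap.ker p ≤ LinearMap.ker g) : ∃ j : N →ₗ[R] L, j ∘ₗ p = g := by
  refine ⟨(LinearMap.ker p).liftQ g h ∘ₗ (p.quotKerEquivOfSurjective hp).symm.toLinearMap, ?_⟩
  ext x
  have : (p.quotKerEquivOfSurjective hp).symm (p x) = Submodule.Quotient.mk x :=
    (p.quotKerEquivOfSurjective hp).symm_apply_eq.2 rfl
  simp [this]

variable [IsNoetherianRing R] {c : R} {P : Type u} [AddCommGroup P] [Module R P]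

/-- Let `P` be the quotient of the free module `F = R^n` by a projective submodule `K`, and write `K`
as a retract of a free module `E = R^m`, with projection `q` and section `s`. Then `t = s ∘ q` is the
idempotent projection of `E` onto `s(K)`, and `u : F → E` sends `f` to `s(c f)`, which makes sense
because `c F ⊆ K`. -/
theorem IsPerfectTorsion.exists_retract (h : IsPerfectTorsion c P) :
    ∃ (n m : ℕ) (p : (Fin n → R) →ₗ[R] P) (q : (Fin m → R) →ₗ[R] (Fin n → R))
      (t : (Fin m → R) →ₗ[R] (Fin m → R)) (u : (Fin n → R) →ₗ[R] (Fin m → R)),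
      Function.Surjective p ∧ LinearMap.ker p = LinearMap.range q ∧
      (∀ x, q (t x) = q x) ∧ (∀ x, q x = 0 → t x = 0) ∧ (∀ f, q (u f) = c • f) ∧
      (∀ x f, q x = c • f → t x = u f) ∧ (∀ f, t (u f) = u f) ∧
      Module.Projective R (LinearMap.ker q) ∧ ∀ x : P, c • x = 0 := by
  obtain ⟨n, p, hp, hproj, hc⟩ := h
  obtain ⟨m, q, hq⟩ := Module.Finite.exists_fin' R (LinearMap.ker p)
  obtain ⟨s, hs⟩ := Module.projective_lifting_property q LinearMap.id hq
  have hs' : ∀ k, q (s k) = k := fun k => LinearMap.congr_fun hs k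
  let μ : (Fin n → R) →ₗ[R] LinearMap.ker p :=
    LinearMap.codRestrict _ (c • LinearMap.id) fun x => by simp [hc]
  have hμ : ∀ f, (μ f : Fin n → R) = c • f := fun _ => rfl
  refine ⟨n, m, p, (LinearMap.ker p).subtype ∘ₗ q, s ∘ₗ q, s ∘ₗ μ, hp, ?_, fun x => ?_,
    fun x hx => ?_, fun f => ?_, fun x f hx => ?_, fun f => ?_, ?_, hc⟩
  · rw [LinearMap.range_comp, LinearMap.range_eq_top.2 hq, Submodule.map_top,
      Submodule.range_subtype]
  · simp [hs']
  · have : q x = 0 := Subtype.ext hx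
    simp [this]
  · simp [hs', hμ]
  · have : q x = μ f := Subtype.ext hx
    simp [this]
  · simp [hs']
  · rw [LinearMap.ker_comp_of_ker_eq_bot _ (Submodule.ker_subtype _)]
    refine Module.Projective.of_split (M := Fin m → R) (LinearMap.ker q).subtype
      (LinearMap.codRestrict _ (LinearMap.id - s ∘ₗ q) fun x => by simp [hs']) ?_
    ext x : 2
    have : q x = 0 := x.2
    simp [this]

/-- A perfect torsion module becomes a module with a square presentation after adding a suitable
torsion module. With `F`, `E`, `K`, `u` as in `exists_retract` and `E = K ⊕ L`, the module
`W = E / (L + u(F))` works: the kernel of `F × E → P × W` is `K × (L ⊕ u(F)) ≅ E × F`. This is what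
makes localization unnecessary. -/
theorem IsPerfectTorsion.exists_hasSquarePresentation (h : IsPerfectTorsion c P) :
    ∃ (W : Type u) (_ : AddCommGroup W) (_ : Module R W), Module.Finite R W ∧
      (∀ w : W, c • w = 0) ∧ HasSquarePresentation R (P × W) := by
  obtain ⟨n, m, p, q, t, u, hp, hpq, hqt, ht0, hqu, htu, htu', -, hc⟩ := h.exists_retract
  let K := LinearMap.ker q ⊔ LinearMap.range u
  refine ⟨(Fin m → R) ⧸ K, inferInstance, inferInstance, inferInstance, fun w => ?_, ?_⟩
  · obtain ⟨x, rfl⟩ := K.mkQ_surjective w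
    rw [← map_smul, Submodule.mkQ_apply, Submodule.Quotient.mk_eq_zero]
    have : c • x = (c • x - u (q x)) + u (q x) := by abel
    rw [this]
    exact Submodule.add_mem_sup (by simp [hqu]) ⟨_, rfl⟩
  · let T : (Fin n → R) × (Fin m → R) →ₗ[R] (Fin n → R) × (Fin m → R) :=
      (q ∘ₗ LinearMap.snd _ _ _).prod
        ((LinearMap.id - t) ∘ₗ LinearMap.snd _ _ _ + u ∘ₗ LinearMap.fst _ _ _)
    refine hasSquarePresentation_of_free (q := p.prodMap K.mkQ) (T := T)
      (hp.prodMap K.mkQ_surjective) ?_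
    ext ⟨f, x⟩
    have h1 : (f, x) ∈ LinearMap.ker (p.prodMap K.mkQ) ↔ f ∈ LinearMap.range q ∧ x ∈ K := by
      rw [← hpq]
      simp
    rw [h1]
    constructor
    · rintro ⟨⟨y, rfl⟩, hx⟩
      obtain ⟨l, hl, _, ⟨f, rfl⟩, rfl⟩ := Submodule.mem_sup.1 hx
      have hl' : q l = 0 := hl
      refine ⟨(f, t y + l), Prod.ext ?_ ?_⟩
      · simp [T, hqt, hl']
      · have h2 : t (t y) = t y := by
          have := ht0 (t y - y) (by simp [hqt])
          rwa [map_sub, sub_eq_zero] at this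
        simp [T, h2, ht0 l hl']
    · rintro ⟨⟨f', y⟩, hy⟩
      obtain ⟨rfl, rfl⟩ := Prod.ext_iff.1 hy
      exact ⟨⟨y, rfl⟩, Submodule.add_mem_sup (by simp [hqt]) ⟨_, rfl⟩⟩

/-- A perfect torsion module embeds into a finite free module over `R / (c)`, with a cokernel that
is again perfect torsion. In the notation of `exists_retract` the embedding is induced by `u`. -/
theorem IsPerfectTorsion.exists_embedding (h : IsPerfectTorsion c P) (hc : c ∈ nonZeroDivisors R) :
    ∃ (m : ℕ) (j : P →ₗ[R] (Fin m → R ⧸ Ideal.span {c})), Function.Injective j ∧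
      IsPerfectTorsion c ((Fin m → R ⧸ Ideal.span {c}) ⧸ LinearMap.range j) := by
  obtain ⟨n, m, p, q, t, u, hp, hpq, hqt, ht0, hqu, htu, htu', hproj, hcP⟩ := h.exists_retract
  have hcancel : ∀ {k : ℕ} (x : Fin k → R), c • x = 0 → x = 0 := by
    intro k x hx
    ext i
    exact (mem_nonZeroDivisors_iff.1 hc).1 _ (congrFun hx i)
  let r : (Fin m → R) →ₗ[R] (Fin m → R ⧸ Ideal.span {c}) :=
    LinearMap.pi fun i => (Ideal.span {c}).mkQ ∘ₗ LinearMap.proj i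
  have hr : Function.Surjective r := by
    intro y
    choose x hx using fun i => (Ideal.span {c}).mkQ_surjective (y i)
    exact ⟨x, funext hx⟩
  have hrk : ∀ x, r x = 0 ↔ ∃ y, x = c • y := by
    intro x
    have h1 : ∀ i, r x i = 0 ↔ c ∣ x i := fun i => by
      rw [← Ideal.mem_span_singleton, ← Submodule.Quotient.mk_eq_zero (Ideal.span {c})]; rfl
    rw [funext_iff]
    simp only [Pi.zero_apply, h1]
    exact ⟨fun hx => by choose y hy using hx; exact ⟨y, funext hy⟩,
      fun ⟨y, hy⟩ i => ⟨y i, congrFun hy i⟩⟩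
  have hker : LinearMap.ker p = LinearMap.ker (r ∘ₗ u) := by
    rw [hpq]
    ext f
    rw [LinearMap.mem_ker, LinearMap.comp_apply, hrk]
    constructor
    · rintro ⟨x, rfl⟩
      exact ⟨t x, by rw [← htu (c • x) (q x) (by simp), map_smul]⟩
    · rintro ⟨y, hy⟩
      refine ⟨y, ?_⟩
      have h2 := hqu f
      rw [hy, map_smul, ← sub_eq_zero, ← smul_sub] at h2
      exact sub_eq_zero.1 (hcancel _ h2)
  obtain ⟨j, hj⟩ := exists_comp_eq_of_ker_le hp _ hker.le
  have hj' : ∀ f, j (p f) = r (u f) := fun f => LinearMap.congr_fun hj f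
  refine ⟨m, j, ?_, m, (LinearMap.range j).mkQ ∘ₗ r, (Submodule.mkQ_surjective _).comp hr, ?_, ?_⟩
  · rw [injective_iff_map_eq_zero]
    intro x hx
    obtain ⟨f, rfl⟩ := hp x
    have : f ∈ LinearMap.ker p := by
      rw [hker]
      simpa [hj'] using hx
    exact this
  · -- the kernel is `u(F) ⊕ c L ≅ F × L`, where `L = ker q`
    let v : (Fin n → R) × LinearMap.ker q →ₗ[R] (Fin m → R) :=
      u.coprod (c • (LinearMap.ker q).subtype)
    have hv : ∀ f l, v (f, l) = u f + c • (l : Fin m → R) := fun f l => rfl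
    have hvinj : Function.Injective v := by
      rw [injective_iff_map_eq_zero]
      rintro ⟨f, l, hl⟩ hfl
      have hl' : q l = 0 := hl
      rw [hv] at hfl
      have h3 := congrArg q hfl
      rw [map_add, hqu, map_smul, hl', smul_zero, add_zero, map_zero] at h3
      have hf := hcancel _ h3
      subst hf
      rw [map_zero, zero_add] at hfl
      have := hcancel _ hfl
      exact Prod.ext rfl (Subtype.ext this)
    have hrange : LinearMap.ker ((LinearMap.range j).mkQ ∘ₗ r) = LinearMap.range v := by
      ext x
      rw [LinearMap.mem_ker, LinearMap.comp_apply, Submodule.mkQ_apply,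
        Submodule.Quotient.mk_eq_zero]
      constructor
      · rintro ⟨y, hy⟩
        obtain ⟨f, rfl⟩ := hp y
        rw [hj', eq_comm, ← sub_eq_zero, ← map_sub, hrk] at hy
        obtain ⟨z, hz⟩ := hy
        refine ⟨(f + q z, ⟨z - t z, by simp [hqt]⟩), ?_⟩
        have h4 : u (q z) = c • t z := by rw [← htu (c • z) (q z) (by simp), map_smul]
        rw [hv, map_add, h4, smul_sub, ← hz]
        abel
      · rintro ⟨⟨f, l⟩, rfl⟩
        refine ⟨p f, ?_⟩
        rw [hj', hv, map_add, (hrk (c • (l : Fin m → R))).2 ⟨l, rfl⟩, add_zero]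
    rw [hrange]
    exact Module.Projective.of_equiv (LinearEquiv.ofInjective v hvinj)
  · intro x
    obtain ⟨y, rfl⟩ := Submodule.mkQ_surjective _ x
    obtain ⟨z, rfl⟩ := hr y
    rw [← map_smul, ← map_smul, (hrk _).2 ⟨z, rfl⟩, map_zero]

end Perfect

section Fractional

variable {R : Type u} [CommRing R] {c : R} (Q : Type u) [CommRing Q]
  [Algebra R Q] {P X Y Z : Type u} [AddCommGroup P] [Module R P] [AddCommGroup X] [Module R X]
  [AddCommGroup Y] [Module R Y] [AddCommGroup Z] [Module R Z]

theorem isUnit_span_singleton {x : Q} (hx : IsUnit x) : IsUnit (Submodule.span R {x}) := by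
  obtain ⟨y, hy⟩ := hx.exists_right_inv
  refine IsUnit.of_mul_eq_one (Submodule.span R {y}) ?_
  rw [Submodule.span_mul_span, Set.singleton_mul_singleton, hy, Submodule.one_eq_span]

theorem one_div_mul_cancel_of_isUnit {J : Submodule R Q} (hJ : IsUnit J) : 1 / J * J = 1 := by
  obtain ⟨K, hK⟩ := hJ.exists_right_inv
  refine le_antisymm ((mul_comm _ _).trans_le Submodule.mul_one_div_le_one) ?_
  rw [← hK, mul_comm J]
  gcongr
  rw [Submodule.le_div_iff_mul_le, mul_comm, hK]

variable [IsNoetherianRing R]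

theorem HasSquarePresentation.isUnit_fracFitting {V : Type u} [AddCommGroup V] [Module R V]
    (hV : HasSquarePresentation R V) (hc : ∀ x : V, c • x = 0)
    (hcQ : IsUnit (algebraMap R Q c)) : IsUnit (fracFitting R Q V) := by
  obtain ⟨d, hd, n, hdn⟩ := hV.fittingIdeal_eq_span hc
  rw [fracFitting, hd, IsLocalization.coeSubmodule_span_singleton]
  refine isUnit_span_singleton Q (isUnit_of_dvd_unit (map_dvd (algebraMap R Q) hdn) ?_)
  rw [map_pow]
  exact hcQ.pow n

theorem fracFitting_prod [Module.Finite R X] [Module.Finite R Y] :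
    fracFitting R Q (X × Y) = fracFitting R Q X * fracFitting R Q Y := by
  rw [fracFitting, fittingIdeal_prod, IsLocalization.coeSubmodule_mul]; rfl

theorem fracFitting_congr [Module.Finite R X] (e : X ≃ₗ[R] Y) :
    fracFitting R Q X = fracFitting R Q Y := by
  rw [fracFitting, fracFitting, fittingIdeal_congr e]

theorem IsPerfectTorsion.isUnit_fracFitting (hP : IsPerfectTorsion c P)
    (hcQ : IsUnit (algebraMap R Q c)) : IsUnit (fracFitting R Q P) := by
  have := hP.finite
  obtain ⟨W, _, _, _, hW, hsq⟩ := hP.exists_hasSquarePresentation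
  have h1 := hsq.isUnit_fracFitting Q (c := c)
    (fun x => Prod.ext (hP.choose_spec.choose_spec.2.2 _) (hW _)) hcQ
  rw [fracFitting_prod] at h1
  exact isUnit_of_mul_isUnit_left h1

theorem IsPerfectTorsion.fracFitting_eq_mul (hP : IsPerfectTorsion c P)
    (hcQ : IsUnit (algebraMap R Q c)) [Module.Finite R Y] [Module.Finite R Z] {i : Y →ₗ[R] Z}
    {π : Z →ₗ[R] P} (hi : Function.Injective i) (hex : Function.Exact i π)
    (hπ : Function.Surjective π) : fracFitting R Q Z = fracFitting R Q Y * fracFitting R Q P := by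
  have := hP.finite
  obtain ⟨W, _, _, _, hW, hsq⟩ := hP.exists_hasSquarePresentation
  have h1 := hsq.isUnit_fracFitting Q (c := c)
    (fun x => Prod.ext (hP.choose_spec.choose_spec.2.2 _) (hW _)) hcQ
  rw [fracFitting_prod] at h1
  have h2 : fracFitting R Q (Z × W) = fracFitting R Q Y * fracFitting R Q (P × W) := by
    have : fittingIdeal R 0 (Z × W) = fittingIdeal R 0 Y * fittingIdeal R 0 (P × W) := by
      refine fittingIdeal_eq_mul_of_hasSquarePresentation hsq (i := LinearMap.inl R Z W ∘ₗ i)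
        (π := π.prodMap LinearMap.id) (LinearMap.inl_injective.comp hi) ?_
        (hπ.prodMap Function.surjective_id)
      rintro ⟨z, w⟩
      constructor
      · intro h
        obtain ⟨y, rfl⟩ := (hex z).1 (congrArg Prod.fst h)
        exact ⟨y, Prod.ext rfl (congrArg Prod.snd h).symm⟩
      · rintro ⟨y, hy⟩
        rw [← hy]
        exact Prod.ext (hex.apply_apply_eq_zero y) rfl
    rw [fracFitting, this, IsLocalization.coeSubmodule_mul]; rfl
  rw [fracFitting_prod, fracFitting_prod, ← mul_assoc] at h2
  exact (isUnit_of_mul_isUnit_right h1).mul_right_cancel h2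

end Fractional

/-! ### Independence of the shifts of the chosen sequence -/

section Independence

variable {R : Type u} [CommRing R] {c : R} (Q : Type u) [CommRing Q] [Algebra R Q]
  {P P₁ P₂ X Y Y₁ Y₂ : Type u} [AddCommGroup P] [Module R P]
  [AddCommGroup P₁] [Module R P₁] [AddCommGroup P₂] [Module R P₂] [AddCommGroup X] [Module R X]
  [AddCommGroup Y] [Module R Y] [AddCommGroup Y₁] [Module R Y₁] [AddCommGroup Y₂] [Module R Y₂]

theorem smul_pi_quotient_eq_zero {m : ℕ} (x : Fin m → R ⧸ Ideal.span {c}) : c • x = 0 := by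
  ext i
  obtain ⟨y, hy⟩ := Ideal.Quotient.mk_surjective (x i)
  rw [Pi.smul_apply, ← hy, ← Ideal.Quotient.mk_eq_mk, ← Submodule.Quotient.mk_smul]
  exact (Submodule.Quotient.mk_eq_zero _).2
    (Ideal.mul_mem_right _ _ (Ideal.mem_span_singleton_self c))

/-- The kernel of `(a, b) ↦ (a mod i, b - h a)` consists of the pairs `(i x, h (i x))`. -/
theorem exists_linearEquiv_prod_quotient (i : X →ₗ[R] P₁) (h : P₁ →ₗ[R] P₂) :
    Nonempty (((P₁ × P₂) ⧸ LinearMap.range (i.prod (h ∘ₗ i))) ≃ₗ[R]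
      (P₁ ⧸ LinearMap.range i) × P₂) := by
  let T : P₁ × P₂ →ₗ[R] (P₁ ⧸ LinearMap.range i) × P₂ :=
    ((LinearMap.range i).mkQ ∘ₗ LinearMap.fst _ _ _).prod
      (LinearMap.snd _ _ _ - h ∘ₗ LinearMap.fst _ _ _)
  have hT : Function.Surjective T := by
    rintro ⟨a, b⟩
    obtain ⟨a, rfl⟩ := Submodule.mkQ_surjective _ a
    exact ⟨(a, b + h a), by simp [T]⟩
  have hk : LinearMap.range (i.prod (h ∘ₗ i)) = LinearMap.ker T := by
    ext ⟨a, b⟩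
    have : (a, b) ∈ LinearMap.ker T ↔ a ∈ LinearMap.range i ∧ b = h a := by
      simp [T, sub_eq_zero]
    rw [this]
    constructor
    · rintro ⟨x, hx⟩
      obtain ⟨rfl, rfl⟩ := Prod.ext_iff.1 hx
      exact ⟨⟨x, rfl⟩, rfl⟩
    · rintro ⟨⟨x, rfl⟩, rfl⟩
      exact ⟨x, rfl⟩
  exact ⟨(Submodule.quotEquivOfEq _ _ hk).trans (T.quotKerEquivOfSurjective hT)⟩

variable [IsNoetherianRing R]

/-- Two sequences `0 → Yᵢ → Pᵢ → X → 0` are compared through the fibre product of `P₁` and `P₂`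
over `X`, which is an extension of `P₂` by `Y₁` and of `P₁` by `Y₂`. -/
theorem fracFitting_mul_eq_of_surjective (h₁ : IsPerfectTorsion c P₁) (h₂ : IsPerfectTorsion c P₂)
    (hcQ : IsUnit (algebraMap R Q c))
    {i₁ : Y₁ →ₗ[R] P₁} {i₂ : Y₂ →ₗ[R] P₂} {π₁ : P₁ →ₗ[R] X} {π₂ : P₂ →ₗ[R] X}
    (hi₁ : Function.Injective i₁) (hi₂ : Function.Injective i₂) (hex₁ : Function.Exact i₁ π₁)
    (hex₂ : Function.Exact i₂ π₂) (hπ₁ : Function.Surjective π₁) (hπ₂ : Function.Surjective π₂) :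
    fracFitting R Q Y₁ * fracFitting R Q P₂ = fracFitting R Q Y₂ * fracFitting R Q P₁ := by
  have := h₁.finite
  have := h₂.finite
  have : Module.Finite R Y₁ := Module.Finite.of_injective i₁ hi₁
  have : Module.Finite R Y₂ := Module.Finite.of_injective i₂ hi₂
  let Z := LinearMap.eqLocus (π₁ ∘ₗ LinearMap.fst R P₁ P₂) (π₂ ∘ₗ LinearMap.snd R P₁ P₂)
  have hZ : ∀ x : Z, π₁ (x : P₁ × P₂).1 = π₂ (x : P₁ × P₂).2 := fun x => x.2
  let j₁ : Y₁ →ₗ[R] Z := LinearMap.codRestrict Z (LinearMap.inl R P₁ P₂ ∘ₗ i₁) fun y => by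
    simp [Z, hex₁.apply_apply_eq_zero]
  let j₂ : Y₂ →ₗ[R] Z := LinearMap.codRestrict Z (LinearMap.inr R P₁ P₂ ∘ₗ i₂) fun y => by
    simp [Z, hex₂.apply_apply_eq_zero]
  have hj₁ : ∀ y, (j₁ y : P₁ × P₂) = (i₁ y, 0) := fun _ => rfl
  have hj₂ : ∀ y, (j₂ y : P₁ × P₂) = (0, i₂ y) := fun _ => rfl
  rw [← h₂.fracFitting_eq_mul Q hcQ (i := j₁) (π := LinearMap.snd R P₁ P₂ ∘ₗ Z.subtype),
    ← h₁.fracFitting_eq_mul Q hcQ (i := j₂) (π := LinearMap.fst R P₁ P₂ ∘ₗ Z.subtype)]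
  · exact fun a b hab => hi₂ (congrArg (fun z : Z => (z : P₁ × P₂).2) hab)
  · intro x
    constructor
    · intro hx
      have hx' : (x : P₁ × P₂).1 = 0 := hx
      obtain ⟨y, hy⟩ := (hex₂ (x : P₁ × P₂).2).1 (by rw [← hZ, hx', map_zero])
      exact ⟨y, Subtype.ext (by rw [hj₂, hy, ← hx'])⟩
    · rintro ⟨y, rfl⟩
      rfl
  · intro a
    obtain ⟨b, hb⟩ := hπ₂ (π₁ a)
    exact ⟨⟨(a, b), hb.symm⟩, rfl⟩
  · exact fun a b hab => hi₁ (congrArg (fun z : Z => (z : P₁ × P₂).1) hab)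
  · intro x
    constructor
    · intro hx
      have hx' : (x : P₁ × P₂).2 = 0 := hx
      obtain ⟨y, hy⟩ := (hex₁ (x : P₁ × P₂).1).1 (by rw [hZ, hx', map_zero])
      exact ⟨y, Subtype.ext (by rw [hj₁, hy, ← hx'])⟩
    · rintro ⟨y, rfl⟩
      rfl
  · intro b
    obtain ⟨a, ha⟩ := hπ₁ (π₂ b)
    exact ⟨⟨(a, b), ha⟩, rfl⟩

/-- Every linear map from a submodule of a module annihilated by `c` to `R / (c)` extends, that is,
`R / (c)` is an injective module over itself. -/
def HasExtensionProperty (c : R) : Prop :=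
  ∀ (X M : Type u) [AddCommGroup X] [Module R X] [AddCommGroup M] [Module R M],
    (∀ x : M, c • x = 0) → ∀ f : X →ₗ[R] M, Function.Injective f →
      ∀ g : X →ₗ[R] R ⧸ Ideal.span {c}, ∃ h : M →ₗ[R] R ⧸ Ideal.span {c}, h ∘ₗ f = g

/-- Schanuel's lemma for two embeddings of `X` into free modules over a self-injective ring. -/
theorem fracFitting_mul_eq_of_hasExtensionProperty (hext : HasExtensionProperty c) {m n : ℕ}
    {i : X →ₗ[R] (Fin m → R ⧸ Ideal.span {c})} {j : X →ₗ[R] (Fin n → R ⧸ Ideal.span {c})}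
    (hi : Function.Injective i) (hj : Function.Injective j) :
    fracFitting R Q (_ ⧸ LinearMap.range i) * fracFitting R Q (Fin n → R ⧸ Ideal.span {c}) =
      fracFitting R Q (_ ⧸ LinearMap.range j) * fracFitting R Q (Fin m → R ⧸ Ideal.span {c}) := by
  have key : ∀ {m n : ℕ} {i : X →ₗ[R] (Fin m → R ⧸ Ideal.span {c})}
      {j : X →ₗ[R] (Fin n → R ⧸ Ideal.span {c})}, Function.Injective i →
      ∃ h : (Fin m → R ⧸ Ideal.span {c}) →ₗ[R] (Fin n → R ⧸ Ideal.span {c}), h ∘ₗ i = j := by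
    intro m n i j hi
    choose h hh using fun k => hext X (Fin m → R ⧸ Ideal.span {c}) smul_pi_quotient_eq_zero i hi
      (LinearMap.proj k ∘ₗ j)
    refine ⟨LinearMap.pi h, ?_⟩
    ext x k
    exact LinearMap.congr_fun (hh k) x
  obtain ⟨h, hh⟩ := key (j := j) hi
  obtain ⟨k, hk⟩ := key (j := i) hj
  obtain ⟨e₁⟩ := exists_linearEquiv_prod_quotient i h
  obtain ⟨e₂⟩ := exists_linearEquiv_prod_quotient j k
  rw [hh] at e₁
  rw [hk] at e₂
  have hswap : (LinearMap.range (i.prod j)).map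
      (LinearEquiv.prodComm R (Fin m → R ⧸ Ideal.span {c})
        (Fin n → R ⧸ Ideal.span {c})).toLinearMap =
      LinearMap.range (j.prod i) := by
    rw [← LinearMap.range_comp]
    rfl
  have e₃ := Submodule.Quotient.equiv _ _ _ hswap
  rw [← fracFitting_prod, ← fracFitting_prod]
  exact fracFitting_congr Q ((e₁.symm.trans e₃).trans e₂)

/-- A sequence `0 → X → P → Y → 0` with `P` perfect torsion computes the same fractional ideal as
an embedding of `X` into a finite free module over `R / (c)`. -/
theorem IsPerfectTorsion.exists_embedding_fracFitting (hP : IsPerfectTorsion c P)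
    (hc : c ∈ nonZeroDivisors R) (hcQ : IsUnit (algebraMap R Q c)) {i : X →ₗ[R] P} {π : P →ₗ[R] Y}
    (hi : Function.Injective i) (hex : Function.Exact i π) (hπ : Function.Surjective π) :
    ∃ (m : ℕ) (j : X →ₗ[R] (Fin m → R ⧸ Ideal.span {c})), Function.Injective j ∧
      IsUnit (fracFitting R Q (Fin m → R ⧸ Ideal.span {c})) ∧
      fracFitting R Q Y * fracFitting R Q (Fin m → R ⧸ Ideal.span {c}) =
        fracFitting R Q (_ ⧸ LinearMap.range j) * fracFitting R Q P := by
  have := hP.finite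
  have : Module.Finite R Y := Module.Finite.of_surjective π hπ
  obtain ⟨m, e, he, hC⟩ := hP.exists_embedding hc
  have hE : fracFitting R Q (Fin m → R ⧸ Ideal.span {c}) = fracFitting R Q P *
      fracFitting R Q ((Fin m → R ⧸ Ideal.span {c}) ⧸ LinearMap.range e) :=
    hC.fracFitting_eq_mul Q hcQ he (LinearMap.exact_map_mkQ_range e) (Submodule.mkQ_surjective _)
  have hle : LinearMap.range (e ∘ₗ i) ≤ LinearMap.range e := LinearMap.range_comp_le_range i e
  have hkeriff : ∀ x : P, π x = 0 ↔ e x ∈ LinearMap.range (e ∘ₗ i) := by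
    intro x
    rw [hex x]
    constructor
    · rintro ⟨y, rfl⟩
      exact ⟨y, rfl⟩
    · rintro ⟨y, hy⟩
      exact ⟨y, he hy⟩
  obtain ⟨k, hk⟩ := exists_comp_eq_of_ker_le hπ ((LinearMap.range (e ∘ₗ i)).mkQ ∘ₗ e) fun x hx => by
    simpa using (hkeriff x).1 hx
  have hk' : ∀ x, k (π x) = Submodule.Quotient.mk (e x) := fun x => LinearMap.congr_fun hk x
  have hE' : fracFitting R Q (_ ⧸ LinearMap.range (e ∘ₗ i)) = fracFitting R Q Y *
      fracFitting R Q ((Fin m → R ⧸ Ideal.span {c}) ⧸ LinearMap.range e) := by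
    refine hC.fracFitting_eq_mul Q hcQ (i := k) (π := Submodule.factor hle) ?_ ?_
      (Submodule.factor_surjective hle)
    · rw [injective_iff_map_eq_zero]
      intro y hy
      obtain ⟨x, rfl⟩ := hπ y
      rw [hk', Submodule.Quotient.mk_eq_zero] at hy
      exact (hkeriff x).2 hy
    · intro z
      obtain ⟨z, rfl⟩ := Submodule.mkQ_surjective _ z
      constructor
      · intro hz
        obtain ⟨x, rfl⟩ := (Submodule.Quotient.mk_eq_zero _).1 hz
        exact ⟨π x, hk' x⟩
      · rintro ⟨y, hy⟩
        obtain ⟨x, rfl⟩ := hπ y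
        rw [← hy, hk']
        exact (Submodule.Quotient.mk_eq_zero _).2 ⟨x, rfl⟩
  refine ⟨m, e ∘ₗ i, he.comp hi, ?_, ?_⟩
  · rw [hE]
    exact (hP.isUnit_fracFitting Q hcQ).mul (hC.isUnit_fracFitting Q hcQ)
  · rw [hE, hE']
    ring

theorem fracFitting_mul_eq_of_injective (hext : HasExtensionProperty c)
    (hc : c ∈ nonZeroDivisors R) (hcQ : IsUnit (algebraMap R Q c))
    (h₁ : IsPerfectTorsion c P₁) (h₂ : IsPerfectTorsion c P₂)
    {i₁ : X →ₗ[R] P₁} {i₂ : X →ₗ[R] P₂} {π₁ : P₁ →ₗ[R] Y₁} {π₂ : P₂ →ₗ[R] Y₂}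
    (hi₁ : Function.Injective i₁) (hi₂ : Function.Injective i₂) (hex₁ : Function.Exact i₁ π₁)
    (hex₂ : Function.Exact i₂ π₂) (hπ₁ : Function.Surjective π₁) (hπ₂ : Function.Surjective π₂) :
    fracFitting R Q Y₁ * fracFitting R Q P₂ = fracFitting R Q Y₂ * fracFitting R Q P₁ := by
  obtain ⟨m, j₁, hj₁, hu₁, e₁⟩ := h₁.exists_embedding_fracFitting Q hc hcQ hi₁ hex₁ hπ₁
  obtain ⟨n, j₂, hj₂, hu₂, e₂⟩ := h₂.exists_embedding_fracFitting Q hc hcQ hi₂ hex₂ hπ₂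
  have e₃ := fracFitting_mul_eq_of_hasExtensionProperty Q hext hj₁ hj₂
  refine (hu₁.mul hu₂).mul_right_cancel ?_
  calc _ = (fracFitting R Q Y₁ * fracFitting R Q (Fin m → R ⧸ Ideal.span {c})) *
        (fracFitting R Q P₂ * fracFitting R Q (Fin n → R ⧸ Ideal.span {c})) := by ring
    _ = (fracFitting R Q (_ ⧸ LinearMap.range j₁) *
        fracFitting R Q (Fin n → R ⧸ Ideal.span {c})) *
        (fracFitting R Q P₁ * fracFitting R Q P₂) := by rw [e₁]; ring
    _ = (fracFitting R Q (_ ⧸ LinearMap.range j₂) * fracFitting R Q P₂) *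
        (fracFitting R Q P₁ * fracFitting R Q (Fin m → R ⧸ Ideal.span {c})) := by rw [e₃]; ring
    _ = _ := by rw [← e₂]; ring

end Independence

/-! ### The integral group ring -/

section GroupRing

variable {G : Type u} [CommGroup G]

theorem coeff_natCast_mul (N : ℕ) (r : MonoidAlgebra ℤ G) (σ : G) :
    ((N : MonoidAlgebra ℤ G) * r).coeff σ = N * r.coeff σ := by
  let f : MonoidAlgebra ℤ G →+ ℤ := (Finsupp.applyAddHom σ).comp
    (MonoidAlgebra.coeffAddEquiv (R := ℤ) (M := G)).toAddMonoidHom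
  rw [← nsmul_eq_mul, ← nsmul_eq_mul]
  exact map_nsmul f N r

theorem isUnit_algebraMap_natCast {N : ℕ} (hN : N ≠ 0) :
    IsUnit (algebraMap (MonoidAlgebra ℤ G) (MonoidAlgebra ℚ G) N) := by
  rw [map_natCast, ← map_natCast (algebraMap ℚ (MonoidAlgebra ℚ G))]
  exact (IsUnit.mk0 (N : ℚ) (by exact_mod_cast hN)).map _

/-- The character `r ↦ r₁ / N` of the additive group of `ℤ[G]`, where `r₁` is the coefficient of
`r` at `1`. -/
noncomputable def coeffOneChar (G : Type u) [CommGroup G] (N : ℕ) : CharacterModule (MonoidAlgebra ℤ G) :=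
  (QuotientAddGroup.mk' (AddSubgroup.zmultiples (1 : ℚ))).comp <|
    (AddMonoidHom.mulRight (N : ℚ)⁻¹).comp <| (Int.castAddHom ℚ).comp <|
      (Finsupp.applyAddHom (1 : G)).comp
        (MonoidAlgebra.coeffAddEquiv (R := ℤ) (M := G)).toAddMonoidHom

theorem coeffOneChar_apply (N : ℕ) (r : MonoidAlgebra ℤ G) :
    coeffOneChar G N r = ((r.coeff 1 * (N : ℚ)⁻¹ : ℚ) : AddCircle (1 : ℚ)) := rfl

theorem smul_coeffOneChar_single (N : ℕ) (r : MonoidAlgebra ℤ G) (σ : G) :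
    (r • coeffOneChar G N) (MonoidAlgebra.single σ 1) =
      ((r.coeff σ⁻¹ * (N : ℚ)⁻¹ : ℚ) : AddCircle (1 : ℚ)) := by
  rw [CharacterModule.smul_apply, coeffOneChar_apply, smul_eq_mul]
  congr 2
  rw [MonoidAlgebra.coeff_mul_single_eq_coeff_mul (m₂ := σ⁻¹), mul_one]
  exact fun _ _ => mul_eq_one_iff_eq_inv

theorem natCast_mem_nonZeroDivisors {N : ℕ} (hN : N ≠ 0) :
    (N : MonoidAlgebra ℤ G) ∈ nonZeroDivisors (MonoidAlgebra ℤ G) := by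
  rw [mem_nonZeroDivisors_iff_right]
  intro x hx
  ext σ
  have := congrArg (fun y => MonoidAlgebra.coeff y σ) hx
  rw [mul_comm, coeff_natCast_mul] at this
  simpa [hN] using this

theorem characterModule_ext {χ ψ : CharacterModule (MonoidAlgebra ℤ G)}
    (h : ∀ σ, χ (MonoidAlgebra.single σ 1) = ψ (MonoidAlgebra.single σ 1)) : χ = ψ := by
  refine DFunLike.ext _ _ fun x => ?_
  induction x using MonoidAlgebra.induction_linear with
  | zero => rw [map_zero, map_zero]
  | add f g hf hg => rw [map_add, map_add, hf, hg]
  | single σ n =>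
    have : (MonoidAlgebra.single σ n : MonoidAlgebra ℤ G) = n • MonoidAlgebra.single σ 1 := by
      simp
    rw [this, map_zsmul, map_zsmul, h]

variable [Finite G]

instance : Module.Finite ℤ (MonoidAlgebra ℤ G) :=
  Module.Finite.equiv (MonoidAlgebra.coeffLinearEquiv ℤ).symm

instance : IsNoetherianRing (MonoidAlgebra ℤ G) :=
  isNoetherian_of_tower ℤ inferInstance

/-- The chain `2^k X` becomes stationary, and then Nakayama's lemma over `ℤ` provides an odd
integer annihilating its last term. -/
theorem exists_natCast_smul_eq_zero {X : Type u} [AddCommGroup X] [Module (MonoidAlgebra ℤ G) X]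
    (hX : IsFiniteLength (MonoidAlgebra ℤ G) X) :
    ∃ N : ℕ, N ≠ 0 ∧ ∀ x : X, (N : MonoidAlgebra ℤ G) • x = 0 := by
  obtain ⟨_, _⟩ := isFiniteLength_iff_isNoetherian_isArtinian.1 hX
  have : Module.Finite ℤ X := Module.Finite.trans (MonoidAlgebra ℤ G) X
  let f : ℕ →o (Submodule (MonoidAlgebra ℤ G) X)ᵒᵈ :=
    { toFun := fun k => OrderDual.toDual
        (LinearMap.range (((2 ^ k : ℕ) : MonoidAlgebra ℤ G) • LinearMap.id))
      monotone' := monotone_nat_of_le_succ fun k => by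
        rintro _ ⟨x, rfl⟩
        refine ⟨(2 : MonoidAlgebra ℤ G) • x, ?_⟩
        simp only [LinearMap.smul_apply, LinearMap.id_apply, smul_smul]
        push_cast
        rw [pow_succ] }
  obtain ⟨k, hk⟩ := IsArtinian.monotone_stabilizes f
  have hk1 : ∀ x : X, ∃ y : X, (2 ^ (k + 1) : ℤ) • y = (2 ^ k : ℤ) • x := by
    intro x
    have h1 : ((2 ^ k : ℕ) : MonoidAlgebra ℤ G) • x ∈
        LinearMap.range (((2 ^ (k + 1) : ℕ) : MonoidAlgebra ℤ G) •
          (LinearMap.id : X →ₗ[MonoidAlgebra ℤ G] X)) := by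
      have h2 := hk (k + 1) (Nat.le_succ k)
      have h3 := congrArg OrderDual.ofDual h2
      change LinearMap.range _ = LinearMap.range _ at h3
      rw [← h3]
      exact ⟨x, rfl⟩
    obtain ⟨y, hy⟩ := h1
    refine ⟨y, ?_⟩
    simp only [LinearMap.smul_apply, LinearMap.id_apply, Nat.cast_smul_eq_nsmul] at hy
    exact_mod_cast hy
  let V : Submodule ℤ X := LinearMap.range ((2 ^ k : ℤ) • LinearMap.id)
  obtain ⟨r, hr, hrV⟩ := Submodule.exists_sub_one_mem_and_smul_eq_zero_of_fg_of_le_smul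
    (Ideal.span {(2 : ℤ)}) V (IsNoetherian.noetherian V) <| by
      rintro _ ⟨x, rfl⟩
      obtain ⟨y, hy⟩ := hk1 x
      have : ((2 ^ k : ℤ) • (LinearMap.id : X →ₗ[ℤ] X)) x = (2 : ℤ) • ((2 ^ k : ℤ) • y) := by
        rw [smul_smul, ← pow_succ', hy]; rfl
      rw [this]
      exact Submodule.smul_mem_smul (Ideal.mem_span_singleton_self _) ⟨y, rfl⟩
  have hr0 : r ≠ 0 := by
    rintro rfl
    rw [Ideal.mem_span_singleton] at hr
    omega
  refine ⟨(r * 2 ^ k).natAbs, by simp [hr0], fun x => ?_⟩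
  have h4 : (r * 2 ^ k : ℤ) • x = 0 := by
    rw [← smul_smul]
    exact hrV _ ⟨x, rfl⟩
  rw [Nat.cast_smul_eq_nsmul, ← natCast_zsmul]
  rcases Int.natAbs_eq (r * 2 ^ k) with h | h
  · rw [← h, h4]
  · rw [h, neg_smul, neg_eq_zero] at h4
    exact h4

theorem isFiniteLength_of_finite {X : Type u} [AddCommGroup X] [Module (MonoidAlgebra ℤ G) X]
    [Finite X] : IsFiniteLength (MonoidAlgebra ℤ G) X :=
  isFiniteLength_iff_isNoetherian_isArtinian.2 ⟨inferInstance, inferInstance⟩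

theorem finite_of_natCast_smul_eq_zero {X : Type u} [AddCommGroup X]
    [Module (MonoidAlgebra ℤ G) X] [Module.Finite (MonoidAlgebra ℤ G) X] {N : ℕ} (hN : N ≠ 0)
    (h : ∀ x : X, (N : MonoidAlgebra ℤ G) • x = 0) : Finite X := by
  have : Module.Finite ℤ X := Module.Finite.trans (MonoidAlgebra ℤ G) X
  refine Module.finite_of_fg_torsion X fun {x} => ⟨⟨(N : ℤ), by simpa using hN⟩, ?_⟩
  have := h x
  rw [Nat.cast_smul_eq_nsmul] at this
  change (N : ℤ) • x = 0
  rw [natCast_zsmul, this]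

/-- `ℤ[G] / (N)` is identified with the `N`-torsion of the character module of `ℤ[G]`, which is an
injective `ℤ[G]`-module. -/
theorem hasExtensionProperty_natCast {N : ℕ} (hN : N ≠ 0) :
    HasExtensionProperty (N : MonoidAlgebra ℤ G) := by
  intro X M _ _ _ _ hM f hf g
  let R := MonoidAlgebra ℤ G
  have hNQ : (N : ℚ) ≠ 0 := by exact_mod_cast hN
  let Θ : R →ₗ[R] CharacterModule R := LinearMap.toSpanSingleton R _ (coeffOneChar G N)
  have hΘ : ∀ r, Θ r = r • coeffOneChar G N := fun _ => rfl
  have hker : LinearMap.ker Θ = Ideal.span {(N : R)} := by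
    ext r
    rw [LinearMap.mem_ker, Ideal.mem_span_singleton, hΘ]
    constructor
    · intro h
      have h1 : ∀ σ, ∃ k : ℤ, r.coeff σ = N * k := by
        intro σ
        have h2 := smul_coeffOneChar_single N r σ⁻¹
        rw [h, inv_inv] at h2
        obtain ⟨k, hk⟩ := (AddCircle.coe_eq_zero_iff (1 : ℚ)).1 h2.symm
        refine ⟨k, ?_⟩
        have : (k : ℚ) * N = r.coeff σ := by
          rw [zsmul_eq_mul, mul_one] at hk
          rw [hk]; field_simp
        rw [mul_comm]
        exact_mod_cast this.symm
      choose k hk using h1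
      refine ⟨MonoidAlgebra.ofCoeff (Finsupp.equivFunOnFinite.symm k), ?_⟩
      ext σ
      rw [coeff_natCast_mul]
      simp [hk]
    · rintro ⟨r, rfl⟩
      refine characterModule_ext fun σ => ?_
      rw [smul_coeffOneChar_single]
      refine (AddCircle.coe_eq_zero_iff (1 : ℚ)).2 ⟨r.coeff σ⁻¹, ?_⟩
      rw [coeff_natCast_mul, zsmul_eq_mul, mul_one]
      push_cast
      field_simp
  have hrange : ∀ χ : CharacterModule R, (N : R) • χ = 0 → χ ∈ LinearMap.range Θ := by
    intro χ hχ
    have h1 : ∀ σ : G, ∃ k : ℤ,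
        χ (MonoidAlgebra.single σ⁻¹ 1) = ((k * (N : ℚ)⁻¹ : ℚ) : AddCircle (1 : ℚ)) := by
      intro σ
      obtain ⟨q, hq⟩ := QuotientAddGroup.mk_surjective (χ (MonoidAlgebra.single σ⁻¹ 1))
      have h2 : N • χ (MonoidAlgebra.single σ⁻¹ 1) = 0 := by
        have := congrArg (fun ψ : CharacterModule R => ψ (MonoidAlgebra.single σ⁻¹ 1)) hχ
        simp only [Nat.cast_smul_eq_nsmul] at this
        exact this
      rw [← hq] at h2
      obtain ⟨k, hk⟩ := (AddCircle.coe_eq_zero_iff (1 : ℚ) (x := N • q)).1 h2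
      refine ⟨k, ?_⟩
      rw [← hq]
      congr 1
      rw [zsmul_eq_mul, mul_one, nsmul_eq_mul] at hk
      rw [hk]; field_simp
    choose k hk using h1
    refine ⟨MonoidAlgebra.ofCoeff (Finsupp.equivFunOnFinite.symm k), ?_⟩
    rw [hΘ]
    refine characterModule_ext fun σ => ?_
    have := hk σ⁻¹
    rw [inv_inv] at this
    rw [smul_coeffOneChar_single, this]
    simp
  -- `Θ` induces an embedding `θ` of `R / (N)` with the same image
  obtain ⟨θ, hθ⟩ := exists_comp_eq_of_ker_le (Ideal.span {(N : R)}).mkQ_surjective Θ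
    (by rw [Submodule.ker_mkQ, hker])
  have hθ' : ∀ r, θ ((Ideal.span {(N : R)}).mkQ r) = Θ r := fun r => LinearMap.congr_fun hθ r
  have hθinj : Function.Injective θ := by
    rw [injective_iff_map_eq_zero]
    intro y hy
    obtain ⟨r, rfl⟩ := Submodule.mkQ_surjective _ y
    rw [hθ', ← LinearMap.mem_ker, hker] at hy
    exact (Submodule.Quotient.mk_eq_zero _).2 hy
  have hinj : Module.Injective R (CharacterModule R) :=
    Module.Flat.iff_characterModule_injective.1 inferInstance
  obtain ⟨H, hH⟩ := hinj.out f hf (θ ∘ₗ g)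
  have hHr : ∀ x, H x ∈ LinearMap.range θ := by
    intro x
    obtain ⟨r, hr⟩ := hrange (H x) (by rw [← map_smul, hM, map_zero])
    exact ⟨_, (hθ' r).trans hr⟩
  refine ⟨(LinearEquiv.ofInjective θ hθinj).symm.toLinearMap ∘ₗ H.codRestrict _ hHr, ?_⟩
  ext x
  apply hθinj
  have h5 := LinearEquiv.apply_symm_apply (LinearEquiv.ofInjective θ hθinj)
    (H.codRestrict _ hHr (f x))
  exact (congrArg Subtype.val h5).trans (hH x)

end GroupRing

/-! ### Shifts over the integral group ring -/

section Shifts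

variable {R : Type u} [CommRing R]

theorem Resolution.altProd_one (S : Resolution R 1) (Q : Type u) [CommRing Q] [Algebra R Q] :
    S.altProd Q = 1 / fracFitting R Q (S.M 1) := by
  simp [Resolution.altProd]

/-- The resolution given by a short exact sequence. -/
def Resolution.ofExact {Y P X : Type u} [AddCommGroup Y] [Module R Y] [AddCommGroup P]
    [Module R P] [AddCommGroup X] [Module R X] {i : Y →ₗ[R] P} {π : P →ₗ[R] X}
    (hi : Function.Injective i) (hex : Function.Exact i π) (hπ : Function.Surjective π)
    (hY : IsFiniteLength R Y) (hP : IsFiniteLength R P) (hX : IsFiniteLength R X)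
    (hpd : CategoryTheory.HasProjectiveDimensionLE (ModuleCat.of R P) 1) : Resolution R 1 where
  M
    | 0 => ModuleCat.of R Y
    | 1 => ModuleCat.of R P
    | _ + 2 => ModuleCat.of R X
  f
    | 0 => i
    | 1 => π
    | _ + 2 => 0
  injective := hi
  surjective := hπ
  exact j hj := by
    obtain rfl : j = 0 := by omega
    exact hex
  isFiniteLength
    | 0, _ => hY
    | 1, _ => hP
    | _ + 2, _ => hX
  projectiveDimension_le j hj := by
    obtain rfl : j = 1 := by simpa using hj
    exact hpd

open CategoryTheory in
theorem hasProjectiveDimensionLE_quotient_span_singleton {g : R} (hg : g ∈ nonZeroDivisors R) :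
    HasProjectiveDimensionLE (ModuleCat.of R (R ⧸ Ideal.span {g})) 1 := by
  let S : ShortComplex (ModuleCat.{u} R) :=
    ShortComplex.mk (ModuleCat.ofHom (LinearMap.mulLeft R g))
      (ModuleCat.ofHom (Ideal.span {g}).mkQ) (by
        ext
        exact (Submodule.Quotient.mk_eq_zero _).2
          (Ideal.mul_mem_right _ _ (Ideal.mem_span_singleton_self g)))
  have hS : S.ShortExact :=
    { exact := (ShortComplex.ShortExact.moduleCat_exact_iff_function_exact S).2 <| by
        intro x
        refine (Submodule.Quotient.mk_eq_zero _).trans (Ideal.mem_span_singleton.trans ?_)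
        exact ⟨fun ⟨y, hy⟩ => ⟨y, hy.symm⟩, fun ⟨y, hy⟩ => ⟨y, hy.symm⟩⟩
      mono_f := (ModuleCat.mono_iff_injective _).2 <| by
        refine (injective_iff_map_eq_zero (LinearMap.mulLeft R g)).2 fun x hx => ?_
        exact (mem_nonZeroDivisors_iff.1 hg).1 x hx
      epi_g := (ModuleCat.epi_iff_surjective _).2 (Submodule.mkQ_surjective _) }
  have h2 : Projective S.X₂ := (IsProjective.iff_projective _).1 (inferInstanceAs
    (Module.Projective R R))
  have h1 : HasProjectiveDimensionLT S.X₁ 1 := projective_iff_hasProjectiveDimensionLT_one.1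
    ((IsProjective.iff_projective _).1 (inferInstanceAs (Module.Projective R R)))
  exact (hS.hasProjectiveDimensionLT_X₃_iff 0 h2).2 h1

theorem one_div_mul_eq_of_mul_eq {R Q : Type u} [CommRing R] [CommRing Q] [Algebra R Q]
    {p₁ p₂ y₁ y₂ : Submodule R Q} (h₁ : IsUnit p₁) (h₂ : IsUnit p₂) (h : y₁ * p₂ = y₂ * p₁) :
    1 / p₁ * y₁ = 1 / p₂ * y₂ := by
  refine (h₁.mul h₂).mul_right_cancel ?_
  calc 1 / p₁ * y₁ * (p₁ * p₂) = (1 / p₁ * p₁) * (y₁ * p₂) := by ring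
    _ = (1 / p₂ * p₂) * (y₂ * p₁) := by
      rw [one_div_mul_cancel_of_isUnit Q h₁, one_div_mul_cancel_of_isUnit Q h₂, h]
    _ = _ := by ring

variable {G : Type u} [CommGroup G]

variable {g w : ℤ[G]} {N : ℕ}

theorem mem_nonZeroDivisors_of_mul_eq_natCast (hN : N ≠ 0) (hgw : g * w = N) :
    g ∈ nonZeroDivisors ℤ[G] :=
  (mul_mem_nonZeroDivisors.1 (hgw ▸ natCast_mem_nonZeroDivisors hN)).1

theorem isUnit_algebraMap_of_mul_eq_natCast (hN : N ≠ 0) (hgw : g * w = N) :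
    IsUnit (algebraMap ℤ[G] ℚ[G] g) :=
  isUnit_of_mul_isUnit_left (y := algebraMap ℤ[G] ℚ[G] w)
    (by rw [← map_mul, hgw]; exact isUnit_algebraMap_natCast hN)

variable [Finite G]

variable {X Y P : Type u} [AddCommGroup X] [Module ℤ[G] X] [AddCommGroup Y] [Module ℤ[G] Y]
  [AddCommGroup P] [Module ℤ[G] P]

theorem Resolution.exists_isPerfectTorsion (S T : Resolution ℤ[G] 1) : ∃ N : ℕ, N ≠ 0 ∧
    IsPerfectTorsion (N : ℤ[G]) (S.M 1) ∧ IsPerfectTorsion (N : ℤ[G]) (T.M 1) := by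
  have hS := S.isFiniteLength 1 (by norm_num)
  have hT := T.isFiniteLength 1 (by norm_num)
  obtain ⟨_, -⟩ := isFiniteLength_iff_isNoetherian_isArtinian.1 hS
  obtain ⟨_, -⟩ := isFiniteLength_iff_isNoetherian_isArtinian.1 hT
  have := S.projectiveDimension_le 1 (by simp)
  have := T.projectiveDimension_le 1 (by simp)
  obtain ⟨N₁, h₁, hN₁⟩ := exists_natCast_smul_eq_zero hS
  obtain ⟨N₂, h₂, hN₂⟩ := exists_natCast_smul_eq_zero hT
  refine ⟨N₁ * N₂, mul_ne_zero h₁ h₂, isPerfectTorsion_of_hasProjectiveDimensionLE _ fun x => ?_,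
    isPerfectTorsion_of_hasProjectiveDimensionLE _ fun x => ?_⟩
  · rw [Nat.cast_mul, mul_comm, mul_smul, hN₁, smul_zero]
  · rw [Nat.cast_mul, mul_smul, hN₂, smul_zero]

theorem IsSFitt.unique {J J' : Submodule ℤ[G] ℚ[G]} (h : IsSFitt ℤ[G] ℚ[G] 1 X J)
    (h' : IsSFitt ℤ[G] ℚ[G] 1 X J') : J = J' := by
  obtain ⟨S, ⟨e⟩, rfl⟩ := h
  obtain ⟨T, ⟨e'⟩, rfl⟩ := h'
  obtain ⟨N, hN, hS, hT⟩ := S.exists_isPerfectTorsion T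
  have hQ := isUnit_algebraMap_natCast (G := G) hN
  rw [S.altProd_one, T.altProd_one]
  refine one_div_mul_eq_of_mul_eq (hS.isUnit_fracFitting _ hQ) (hT.isUnit_fracFitting _ hQ) ?_
  refine fracFitting_mul_eq_of_surjective _ hS hT hQ (i₁ := S.f 0) (i₂ := T.f 0)
    (π₁ := e.symm.toLinearMap ∘ₗ S.f 1) (π₂ := e'.symm.toLinearMap ∘ₗ T.f 1)
    S.injective T.injective ?_ ?_ (e.symm.surjective.comp S.surjective)
    (e'.symm.surjective.comp T.surjective)
  · exact (S.exact 0 one_pos).comp_injective _ e.symm.injective (map_zero e.symm)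
  · exact (T.exact 0 one_pos).comp_injective _ e'.symm.injective (map_zero e'.symm)

theorem IsSFittNeg.unique {J J' : Submodule ℤ[G] ℚ[G]} (h : IsSFittNeg ℤ[G] ℚ[G] 1 X J)
    (h' : IsSFittNeg ℤ[G] ℚ[G] 1 X J') : J = J' := by
  obtain ⟨S, ⟨e⟩, rfl⟩ := h
  obtain ⟨T, ⟨e'⟩, rfl⟩ := h'
  obtain ⟨N, hN, hS, hT⟩ := S.exists_isPerfectTorsion T
  have hQ := isUnit_algebraMap_natCast (G := G) hN
  rw [S.altProd_one, T.altProd_one]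
  refine one_div_mul_eq_of_mul_eq (hS.isUnit_fracFitting _ hQ) (hT.isUnit_fracFitting _ hQ) ?_
  refine fracFitting_mul_eq_of_injective _ (hasExtensionProperty_natCast hN)
    (natCast_mem_nonZeroDivisors hN) hQ hS hT (i₁ := S.f 0 ∘ₗ e.toLinearMap)
    (i₂ := T.f 0 ∘ₗ e'.toLinearMap) (π₁ := S.f 1) (π₂ := T.f 1)
    (S.injective.comp e.injective) (T.injective.comp e'.injective) ?_ ?_ S.surjective T.surjective
  · intro x
    rw [(S.exact 0 one_pos) x, LinearMap.coe_comp, LinearEquiv.coe_coe,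
      e.surjective.range_comp]
  · intro x
    rw [(T.exact 0 one_pos) x, LinearMap.coe_comp, LinearEquiv.coe_coe,
      e'.surjective.range_comp]

theorem isSFitt_iff {J₀ : Submodule ℤ[G] ℚ[G]} (h : IsSFitt ℤ[G] ℚ[G] 1 X J₀) (J : Submodule ℤ[G] ℚ[G]) :
    IsSFitt ℤ[G] ℚ[G] 1 X J ↔ J = SFitt ℤ[G] ℚ[G] 1 X := by
  have hs : IsSFitt ℤ[G] ℚ[G] 1 X (SFitt ℤ[G] ℚ[G] 1 X) := Classical.epsilon_spec ⟨_, h⟩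
  exact ⟨fun hJ => hJ.unique hs, fun hJ => hJ ▸ hs⟩

theorem isSFittNeg_iff {J₀ : Submodule ℤ[G] ℚ[G]} (h : IsSFittNeg ℤ[G] ℚ[G] 1 X J₀)
    (J : Submodule ℤ[G] ℚ[G]) : IsSFittNeg ℤ[G] ℚ[G] 1 X J ↔ J = SFittNeg ℤ[G] ℚ[G] 1 X := by
  have hs : IsSFittNeg ℤ[G] ℚ[G] 1 X (SFittNeg ℤ[G] ℚ[G] 1 X) := Classical.epsilon_spec ⟨_, h⟩
  exact ⟨fun hJ => hJ.unique hs, fun hJ => hJ ▸ hs⟩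

theorem finite_quotient_of_mul_eq_natCast (hN : N ≠ 0) (hgw : g * w = N) {J : Ideal ℤ[G]}
    (hJ : g ∈ J) : Finite (ℤ[G] ⧸ J) := by
  refine finite_of_natCast_smul_eq_zero (G := G) hN fun x => ?_
  obtain ⟨r, rfl⟩ := J.mkQ_surjective x
  rw [← map_smul, ← hgw]
  refine (Submodule.Quotient.mk_eq_zero _).2 ?_
  rw [smul_eq_mul, mul_assoc]
  exact J.mul_mem_right _ hJ

theorem fracFitting_quotient (J : Ideal ℤ[G]) :
    fracFitting ℤ[G] ℚ[G] (ℤ[G] ⧸ J) = IsLocalization.coeSubmodule ℚ[G] J := by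
  rw [fracFitting, fittingIdeal_quotient]

/-- A sequence `0 → Y → ℤ[G] / (g) → X → 0` computes the first shift. -/
theorem isSFitt_of_exact (hN : N ≠ 0) (hgw : g * w = N)
    {i : Y →ₗ[ℤ[G]] (ℤ[G] ⧸ Ideal.span {g})} {π : (ℤ[G] ⧸ Ideal.span {g}) →ₗ[ℤ[G]] X}
    (hi : Function.Injective i) (hex : Function.Exact i π) (hπ : Function.Surjective π) :
    IsSFitt ℤ[G] ℚ[G] 1 X (1 / Submodule.span ℤ[G] {algebraMap ℤ[G] ℚ[G] g} * fracFitting ℤ[G] ℚ[G] Y) := by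
  have := finite_quotient_of_mul_eq_natCast hN hgw (Ideal.mem_span_singleton_self g)
  have := Finite.of_injective i hi
  have := Finite.of_surjective π hπ
  refine ⟨Resolution.ofExact hi hex hπ isFiniteLength_of_finite isFiniteLength_of_finite
    isFiniteLength_of_finite (hasProjectiveDimensionLE_quotient_span_singleton
      (mem_nonZeroDivisors_of_mul_eq_natCast hN hgw)), ⟨LinearEquiv.refl _ _⟩, ?_⟩
  rw [Resolution.altProd_one, ← IsLocalization.coeSubmodule_span_singleton,
    ← fracFitting_quotient]
  rfl

/-- A sequence `0 → X → ℤ[G] / (g) → Y → 0` computes the negative shift. -/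
theorem isSFittNeg_of_exact (hN : N ≠ 0) (hgw : g * w = N)
    {i : X →ₗ[ℤ[G]] (ℤ[G] ⧸ Ideal.span {g})} {π : (ℤ[G] ⧸ Ideal.span {g}) →ₗ[ℤ[G]] Y}
    (hi : Function.Injective i) (hex : Function.Exact i π) (hπ : Function.Surjective π) :
    IsSFittNeg ℤ[G] ℚ[G] 1 X (1 / Submodule.span ℤ[G] {algebraMap ℤ[G] ℚ[G] g} * fracFitting ℤ[G] ℚ[G] Y) := by
  have := finite_quotient_of_mul_eq_natCast hN hgw (Ideal.mem_span_singleton_self g)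
  have := Finite.of_injective i hi
  have := Finite.of_surjective π hπ
  refine ⟨Resolution.ofExact hi hex hπ isFiniteLength_of_finite isFiniteLength_of_finite
    isFiniteLength_of_finite (hasProjectiveDimensionLE_quotient_span_singleton
      (mem_nonZeroDivisors_of_mul_eq_natCast hN hgw)), ⟨LinearEquiv.refl _ _⟩, ?_⟩
  rw [Resolution.altProd_one, ← IsLocalization.coeSubmodule_span_singleton,
    ← fracFitting_quotient]
  rfl

end Shifts

/-! ### The norm element and the relative augmentation ideal -/

section Norm

variable {G : Type u} [CommGroup G]

/-- `1 + k - σ` divides `(1 + k)^n - 1`, where `n` is the order of `σ`. -/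
theorem exists_mul_eq_natCast {H : Type*} [CommGroup H] [Finite H] (σ : H) {k : ℕ} (hk : k ≠ 0) :
    ∃ (w : ℤ[H]) (N : ℕ), N ≠ 0 ∧ (1 - MonoidAlgebra.single σ 1 + (k : ℤ[H])) * w = (N : ℤ[H]) := by
  obtain ⟨w, hw⟩ := sub_dvd_pow_sub_pow ((1 + k : ℕ) : ℤ[H]) (MonoidAlgebra.single σ 1)
    (orderOf σ)
  have h1 : 1 < (1 + k) ^ orderOf σ := Nat.one_lt_pow (orderOf_pos σ).ne' (by omega)
  refine ⟨w, (1 + k) ^ orderOf σ - 1, by omega, ?_⟩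
  rw [Nat.cast_sub h1.le, Nat.cast_pow, Nat.cast_one]
  rw [MonoidAlgebra.single_pow, pow_orderOf_eq_one, one_pow, ← MonoidAlgebra.one_def] at hw
  rw [hw]
  push_cast
  ring

variable (I : Subgroup G)

/-- The projection `ℤ[G] → ℤ[G/I]`. -/
noncomputable abbrev projHom : ℤ[G] →+* ℤ[G ⧸ I] :=
  MonoidAlgebra.mapDomainRingHom ℤ (QuotientGroup.mk' I)

/-- The ideal of `ℤ[G]` generated by the elements `τ - 1` for `τ ∈ I`. -/
noncomputable def augIdeal : Ideal ℤ[G] :=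
  Ideal.span (Set.range fun τ : I => MonoidAlgebra.single (τ : G) 1 - 1)

/-- The norm element `ν_I` in `ℤ[G]`. -/
noncomputable def intNorm : ℤ[G] := ∑ᶠ τ : I, MonoidAlgebra.single (τ : G) 1

theorem algebraMap_projHom (x : ℤ[G]) :
    algebraMap ℤ[G ⧸ I] ℚ[G ⧸ I] (projHom I x) =
      MonoidAlgebra.mapDomainRingHom ℚ (QuotientGroup.mk' I) (algebraMap ℤ[G] ℚ[G] x) :=
  RingHom.congr_fun (MonoidAlgebra.mapRingHom_comp_mapDomainRingHom (Int.castRingHom ℚ)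
    (QuotientGroup.mk' I)) x

theorem coeff_algebraMap {H : Type*} [CommGroup H] (x : ℤ[H]) (σ : H) :
    (algebraMap ℤ[H] ℚ[H] x).coeff σ = x.coeff σ :=
  MonoidAlgebra.coeff_mapRingHom _ _ _

theorem projHom_single (σ : G) (n : ℤ) :
    projHom I (MonoidAlgebra.single σ n) = MonoidAlgebra.single (σ : G ⧸ I) n := by
  simp [projHom]

theorem projHom_surjective : Function.Surjective (projHom I) := by
  intro z
  refine ⟨MonoidAlgebra.mapDomain Quotient.out z, ?_⟩
  induction z using MonoidAlgebra.induction_linear with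
  | zero => simp
  | add f g hf hg => rw [MonoidAlgebra.mapDomain_add, map_add, hf, hg]
  | single σ n => rw [MonoidAlgebra.mapDomain_single, projHom_single, QuotientGroup.out_eq']

theorem sub_mem_augIdeal {σ σ' : G} (h : (σ : G ⧸ I) = σ') (n : ℤ) :
    MonoidAlgebra.single σ n - MonoidAlgebra.single σ' n ∈ augIdeal I := by
  have h1 : σ'⁻¹ * σ ∈ I := QuotientGroup.eq.1 h.symm
  have h2 : (MonoidAlgebra.single σ n - MonoidAlgebra.single σ' n : ℤ[G]) =
      MonoidAlgebra.single σ' n * (MonoidAlgebra.single (σ'⁻¹ * σ) 1 - 1) := by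
    rw [mul_sub, MonoidAlgebra.single_mul_single, mul_inv_cancel_left, mul_one, mul_one]
  rw [h2]
  exact Ideal.mul_mem_left _ _ (Ideal.subset_span ⟨⟨_, h1⟩, rfl⟩)

theorem projHom_eq_zero_iff {x : ℤ[G]} : projHom I x = 0 ↔ x ∈ augIdeal I := by
  constructor
  · intro hx
    have h1 : ∀ x : ℤ[G], x - MonoidAlgebra.mapDomain Quotient.out (projHom I x) ∈ augIdeal I := by
      intro x
      induction x using MonoidAlgebra.induction_linear with
      | zero => simp
      | add f g hf hg =>
        rw [map_add, MonoidAlgebra.mapDomain_add, add_sub_add_comm]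
        exact Ideal.add_mem _ hf hg
      | single σ n =>
        rw [projHom_single, MonoidAlgebra.mapDomain_single]
        exact sub_mem_augIdeal I (QuotientGroup.out_eq' _).symm n
    have h2 := h1 x
    rwa [hx, MonoidAlgebra.mapDomain_zero, sub_zero] at h2
  · intro hx
    have : augIdeal I ≤ RingHom.ker (projHom I) := by
      refine Ideal.span_le.2 ?_
      rintro _ ⟨τ, rfl⟩
      rw [SetLike.mem_coe, RingHom.mem_ker, map_sub, projHom_single, map_one, sub_eq_zero,
        (QuotientGroup.eq_one_iff (τ : G)).2 τ.2]
      rfl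
    exact this hx

variable [Finite G]

theorem algebraMap_intNorm : algebraMap ℤ[G] ℚ[G] (intNorm I) = normElt I := by
  have := Fintype.ofFinite I
  rw [intNorm, normElt, finsum_eq_sum_of_fintype, finsum_eq_sum_of_fintype, map_sum]
  refine Finset.sum_congr rfl fun τ _ => ?_
  simp

theorem coeff_intNorm_mul (x : ℤ[G]) (σ : G) :
    (intNorm I * x).coeff σ = (projHom I x).coeff (σ : G ⧸ I) := by
  have h := congrArg (fun y => MonoidAlgebra.coeff y σ) (normMul_map I (algebraMap ℤ[G] ℚ[G] x))
  rw [← algebraMap_intNorm, ← map_mul, ← algebraMap_projHom] at h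
  simp only [normMul, Finsupp.equivFunOnFinite_symm_apply_apply, coeff_algebraMap] at h
  exact_mod_cast h.symm

theorem intNorm_mul_eq_zero_iff {x : ℤ[G]} : intNorm I * x = 0 ↔ x ∈ augIdeal I := by
  rw [← projHom_eq_zero_iff]
  constructor
  · intro h
    ext q
    obtain ⟨σ, rfl⟩ := QuotientGroup.mk_surjective q
    rw [← coeff_intNorm_mul, h]
    rfl
  · intro h
    ext σ
    rw [coeff_intNorm_mul, h]
    rfl

/-- The annihilator of the relative augmentation ideal is generated by the norm element. -/
theorem exists_eq_intNorm_mul {x : ℤ[G]}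
    (hx : ∀ τ : I, (MonoidAlgebra.single (τ : G) 1 - 1) * x = 0) : ∃ y, x = intNorm I * y := by
  have h1 : ∀ τ : I, ∀ σ, x.coeff ((τ : G)⁻¹ * σ) = x.coeff σ := by
    intro τ σ
    have h2 := hx τ
    rw [sub_mul, one_mul, sub_eq_zero] at h2
    have h3 := congrArg (fun y => MonoidAlgebra.coeff y σ) h2
    simpa using h3
  obtain ⟨y, hy⟩ := projHom_surjective I
    (MonoidAlgebra.ofCoeff (Finsupp.equivFunOnFinite.symm fun q => x.coeff q.out))
  refine ⟨y, ?_⟩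
  ext σ
  rw [coeff_intNorm_mul, hy]
  have h4 : (Quotient.out (σ : G ⧸ I))⁻¹ * σ ∈ I :=
    QuotientGroup.eq.1 (QuotientGroup.out_eq' (σ : G ⧸ I))
  have h5 := h1 ⟨_, h4⟩ σ
  simp only [mul_inv_rev, inv_inv] at h5
  simp only [Finsupp.equivFunOnFinite_symm_apply_apply]
  rw [← h5]
  congr 1
  rw [mul_comm σ⁻¹, inv_mul_cancel_right]

/-- The Fitting ideal of the relative augmentation ideal annihilates it. -/
theorem detIdeal_ker_le_span_intNorm {n : ℕ} {p : (Fin n → ℤ[G]) →ₗ[ℤ[G]] augIdeal I}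
    (hp : Function.Surjective p) : detIdeal (LinearMap.ker p) ≤ Ideal.span {intNorm I} := by
  refine Ideal.span_le.2 ?_
  rintro _ ⟨M, hM, rfl⟩
  have hsingle : ∀ j, M.det • Pi.single j 1 ∈ LinearMap.ker p := by
    intro j
    have : M.det • (Pi.single j 1 : Fin n → ℤ[G]) = ∑ i, M.adjugate j i • M i := by
      ext k
      have h := congrFun (congrFun (Matrix.adjugate_mul M) j) k
      rw [Matrix.mul_apply] at h
      simp only [Finset.sum_apply, Pi.smul_apply, smul_eq_mul, h, Matrix.smul_apply,
        Matrix.one_apply, Pi.single_apply, eq_comm]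
    rw [this]
    exact Submodule.sum_mem _ fun i _ => Submodule.smul_mem _ _ (hM i)
  have hall : ∀ a : augIdeal I, M.det • a = 0 := by
    intro a
    obtain ⟨x, rfl⟩ := hp a
    rw [← map_smul, ← LinearMap.mem_ker, pi_eq_sum_univ' x, Finset.smul_sum]
    refine Submodule.sum_mem _ fun j _ => ?_
    rw [smul_comm]
    exact Submodule.smul_mem _ _ (hsingle j)
  obtain ⟨y, hy⟩ := exists_eq_intNorm_mul I (x := M.det) fun τ => by
    rw [mul_comm]
    exact congrArg Subtype.val (hall ⟨_, Ideal.subset_span ⟨τ, rfl⟩⟩)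
  exact Ideal.mem_span_singleton.2 ⟨y, hy⟩

end Norm

/-! ### The shifts of the module `A` -/

section Computation

variable {G : Type u} [CommGroup G] (I : Subgroup G) (φ : G ⧸ I)

/-- The projection `ℤ[G] → A`. -/
noncomputable def toA : ℤ[G] →ₗ[ℤ[G]] A I φ where
  toFun x := Ideal.Quotient.mk (Ideal.span {gElt I φ}) (projHom I x)
  map_add' x y := by rw [map_add, map_add]; rfl
  map_smul' r x := by rw [smul_eq_mul, map_mul, map_mul]; rfl

theorem toA_surjective : Function.Surjective (toA I φ) :=
  Ideal.Quotient.mk_surjective.comp (projHom_surjective I)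

theorem toA_eq_zero_iff_dvd {x : ℤ[G]} : toA I φ x = 0 ↔ gElt I φ ∣ projHom I x :=
  Ideal.Quotient.eq_zero_iff_dvd _ _

variable {I φ} in
theorem toA_eq_zero_iff {g : ℤ[G]} (hg : projHom I g = gElt I φ) {x : ℤ[G]} :
    toA I φ x = 0 ↔ ∃ y, x - g * y ∈ augIdeal I := by
  rw [toA_eq_zero_iff_dvd, ← hg]
  constructor
  · rintro ⟨z, hz⟩
    obtain ⟨y, rfl⟩ := projHom_surjective I z
    exact ⟨y, (projHom_eq_zero_iff I).1 (by rw [map_sub, map_mul, hz, sub_self])⟩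
  · rintro ⟨y, hy⟩
    rw [← projHom_eq_zero_iff, map_sub, map_mul, sub_eq_zero] at hy
    exact ⟨_, hy⟩

variable [Finite G]

theorem exists_gElt_mul_eq_natCast :
    ∃ (w : ℤ[G ⧸ I]) (N : ℕ), N ≠ 0 ∧ gElt I φ * w = (N : ℤ[G ⧸ I]) :=
  exists_mul_eq_natCast φ⁻¹ Nat.card_pos.ne'

/-- A lift of `g` to `ℤ[G]` that divides a nonzero integer. -/
theorem exists_lift_gElt : ∃ (g w : ℤ[G]) (N : ℕ), N ≠ 0 ∧ g * w = (N : ℤ[G]) ∧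
    projHom I g = gElt I φ := by
  obtain ⟨σ, rfl⟩ := QuotientGroup.mk_surjective φ
  obtain ⟨w, N, hN, hw⟩ := exists_mul_eq_natCast σ⁻¹ (k := Nat.card I) Nat.card_pos.ne'
  refine ⟨_, w, N, hN, hw, ?_⟩
  rw [map_add, map_sub, map_one, projHom_single, map_natCast]
  rfl

variable {I φ} {g w : ℤ[G]} {N : ℕ}

theorem mem_augIdeal_of_mul_mem (hg : projHom I g = gElt I φ) {y : ℤ[G]}
    (hy : g * y ∈ augIdeal I) : y ∈ augIdeal I := by
  rw [← projHom_eq_zero_iff, map_mul, hg] at hy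
  obtain ⟨w, N, hN, hw⟩ := exists_gElt_mul_eq_natCast I φ
  exact (projHom_eq_zero_iff I).1
    ((mem_nonZeroDivisors_iff.1 (mem_nonZeroDivisors_of_mul_eq_natCast hN hw)).1 _ hy)

theorem exists_proj_A (hg : projHom I g = gElt I φ) :
    ∃ π : (ℤ[G] ⧸ Ideal.span {g}) →ₗ[ℤ[G]] A I φ, Function.Surjective π ∧
      ∀ x, π (Ideal.Quotient.mk _ x) = toA I φ x := by
  obtain ⟨π, hπ⟩ := exists_comp_eq_of_ker_le (Ideal.span {g}).mkQ_surjective (toA I φ)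
    (by
      rw [Submodule.ker_mkQ]
      intro x hx
      obtain ⟨y, rfl⟩ := Ideal.mem_span_singleton.1 hx
      exact (toA_eq_zero_iff hg).2 ⟨y, by simp⟩)
  have hπ' : ∀ x, π (Ideal.Quotient.mk _ x) = toA I φ x := fun x => LinearMap.congr_fun hπ x
  refine ⟨π, fun a => ?_, hπ'⟩
  obtain ⟨x, rfl⟩ := toA_surjective I φ a
  exact ⟨_, hπ' x⟩

/-- Multiplication by `ν_I` embeds `A` into `ℤ[G] / (g)` with cokernel `ℤ[G] / (g, ν_I)`. -/
theorem isSFittNeg_A (hN : N ≠ 0) (hgw : g * w = N) (hg : projHom I g = gElt I φ) :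
    IsSFittNeg ℤ[G] ℚ[G] 1 (A I φ) (1 / Submodule.span ℤ[G] {algebraMap ℤ[G] ℚ[G] g} *
      fracFitting ℤ[G] ℚ[G] (ℤ[G] ⧸ Ideal.span {g, intNorm I})) := by
  have hgnz := mem_nonZeroDivisors_of_mul_eq_natCast hN hgw
  have hker : ∀ x, toA I φ x = 0 ↔ intNorm I * x ∈ Ideal.span {g} := by
    intro x
    rw [toA_eq_zero_iff hg, Ideal.mem_span_singleton]
    constructor
    · rintro ⟨y, hy⟩
      rw [← intNorm_mul_eq_zero_iff, mul_sub, sub_eq_zero] at hy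
      exact ⟨intNorm I * y, by rw [hy]; ring⟩
    · rintro ⟨y, hy⟩
      obtain ⟨z, rfl⟩ := exists_eq_intNorm_mul I (x := y) fun τ => by
        refine (mem_nonZeroDivisors_iff.1 hgnz).1 _ ?_
        have h1 : intNorm I * (MonoidAlgebra.single (τ : G) 1 - 1) = 0 :=
          (intNorm_mul_eq_zero_iff I).2 (Ideal.subset_span ⟨τ, rfl⟩)
        rw [mul_left_comm, ← hy, ← mul_assoc, mul_comm _ (intNorm I), h1, zero_mul]
      refine ⟨z, (intNorm_mul_eq_zero_iff I).1 ?_⟩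
      rw [mul_sub, hy]
      ring
  obtain ⟨i, hi⟩ := exists_comp_eq_of_ker_le (toA_surjective I φ)
    ((Ideal.span {g}).mkQ ∘ₗ LinearMap.mulLeft ℤ[G] (intNorm I)) fun x hx =>
      (Submodule.Quotient.mk_eq_zero _).2 ((hker x).1 hx)
  have hi' : ∀ x, i (toA I φ x) = Submodule.Quotient.mk (intNorm I * x) :=
    fun x => LinearMap.congr_fun hi x
  have hle : Ideal.span {g} ≤ Ideal.span {g, intNorm I} := Ideal.span_mono (by simp)
  refine isSFittNeg_of_exact hN hgw (i := i) (π := Submodule.factor hle) ?_ ?_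
    (Submodule.factor_surjective hle)
  · rw [injective_iff_map_eq_zero]
    intro a ha
    obtain ⟨x, rfl⟩ := toA_surjective I φ a
    rw [hi', Submodule.Quotient.mk_eq_zero] at ha
    exact (hker x).2 ha
  · intro z
    obtain ⟨z, rfl⟩ := Submodule.mkQ_surjective _ z
    refine (Submodule.Quotient.mk_eq_zero _).trans ?_
    constructor
    · intro hz
      obtain ⟨a, b, rfl⟩ := Ideal.mem_span_pair.1 hz
      refine ⟨toA I φ b, ?_⟩
      rw [hi']
      refine (Submodule.Quotient.eq _).2 (Ideal.mem_span_singleton.2 ⟨-a, by ring⟩)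
    · rintro ⟨a, ha⟩
      obtain ⟨x, rfl⟩ := toA_surjective I φ a
      rw [hi'] at ha
      have h2 := hle ((Submodule.Quotient.eq _).1 ha)
      have h3 : intNorm I * x ∈ Ideal.span {g, intNorm I} :=
        Ideal.mul_mem_right _ _ (Ideal.subset_span (by simp))
      simpa using Ideal.sub_mem _ h3 h2

/-- The kernel of `ℤ[G] / (g) → A`, which is the image of the relative augmentation ideal `𝔞` and
isomorphic to `𝔞 / g𝔞`, has its Fitting ideal in `(g, ν_I)`: modulo `g` it has the same relations
as `𝔞`, whose Fitting ideal annihilates `𝔞`. -/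
theorem fittingIdeal_ker_le (hg : projHom I g = gElt I φ)
    {π : (ℤ[G] ⧸ Ideal.span {g}) →ₗ[ℤ[G]] A I φ}
    (hπ : ∀ x, π (Ideal.Quotient.mk _ x) = toA I φ x) :
    fittingIdeal ℤ[G] 0 (LinearMap.ker π) ≤ Ideal.span {g, intNorm I} := by
  obtain ⟨n, p, hp⟩ := Module.Finite.exists_fin' ℤ[G] (augIdeal I)
  let q : (Fin n → ℤ[G]) →ₗ[ℤ[G]] LinearMap.ker π :=
    LinearMap.codRestrict _ ((Ideal.span {g}).mkQ ∘ₗ (augIdeal I).subtype ∘ₗ p) fun x => by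
      refine (hπ _).trans ((toA_eq_zero_iff hg).2 ⟨0, ?_⟩)
      rw [mul_zero, sub_zero]
      exact (p x).2
  have hq : ∀ x, (q x : ℤ[G] ⧸ Ideal.span {g}) = Submodule.Quotient.mk (p x : ℤ[G]) :=
    fun _ => rfl
  have hqs : Function.Surjective q := by
    rintro ⟨y, hy⟩
    obtain ⟨y, rfl⟩ := Ideal.Quotient.mk_surjective y
    rw [LinearMap.mem_ker, hπ, toA_eq_zero_iff hg] at hy
    obtain ⟨z, hz⟩ := hy
    obtain ⟨x, hx⟩ := hp ⟨_, hz⟩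
    refine ⟨x, Subtype.ext ?_⟩
    rw [hq, hx]
    exact (Submodule.Quotient.eq _).2 (Ideal.mem_span_singleton.2 ⟨-z, by ring⟩)
  rw [fittingIdeal_eq_detIdeal hqs]
  refine Ideal.span_le.2 ?_
  rintro _ ⟨M, hM, rfl⟩
  have hrow : ∀ i, ∃ z, p (M i - g • z) = 0 := by
    intro i
    have h1 := congrArg Subtype.val (LinearMap.mem_ker.1 (hM i))
    rw [hq] at h1
    obtain ⟨y, hy⟩ := Ideal.mem_span_singleton.1 ((Submodule.Quotient.mk_eq_zero _).1 h1)
    have hya : y ∈ augIdeal I := mem_augIdeal_of_mul_mem hg (hy ▸ (p (M i)).2)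
    obtain ⟨z, hz⟩ := hp ⟨y, hya⟩
    refine ⟨z, ?_⟩
    rw [map_sub, map_smul, hz, sub_eq_zero]
    exact Subtype.ext hy
  choose z hz using hrow
  let M' : Matrix (Fin n) (Fin n) ℤ[G] := fun i => M i - g • z i
  have h2 : M'.det ∈ Ideal.span {intNorm I} :=
    detIdeal_ker_le_span_intNorm I hp (det_mem_detIdeal hz)
  have h3 : M.det - M'.det ∈ Ideal.span {g} := by
    rw [← Ideal.Quotient.eq, RingHom.map_det, RingHom.map_det]
    congr 1
    ext i j
    refine Ideal.Quotient.eq.2 (Ideal.mem_span_singleton.2 ⟨z i j, ?_⟩)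
    simp [M']
  have h4 := Ideal.add_mem _ (Ideal.span_mono (by simp) h3 : _ ∈ Ideal.span {g, intNorm I})
    (Ideal.span_mono (by simp) h2)
  simpa using h4

theorem isSFitt_A (hN : N ≠ 0) (hgw : g * w = N)
    {π : (ℤ[G] ⧸ Ideal.span {g}) →ₗ[ℤ[G]] A I φ} (hπs : Function.Surjective π) :
    IsSFitt ℤ[G] ℚ[G] 1 (A I φ) (1 / Submodule.span ℤ[G] {algebraMap ℤ[G] ℚ[G] g} *
      fracFitting ℤ[G] ℚ[G] (LinearMap.ker π)) :=
  isSFitt_of_exact hN hgw (i := (LinearMap.ker π).subtype) (LinearMap.ker π).subtype_injective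
    (LinearMap.exact_subtype_ker_map π) hπs

/-- For `I` generated by `τ`, multiplication by `τ - 1` identifies `ℤ[G] / (g, ν_I)` with the
kernel of `ℤ[G] / (g) → A`. -/
theorem isSFitt_A_of_isCyclic [IsCyclic I] (hN : N ≠ 0) (hgw : g * w = N)
    (hg : projHom I g = gElt I φ) {π : (ℤ[G] ⧸ Ideal.span {g}) →ₗ[ℤ[G]] A I φ}
    (hπs : Function.Surjective π) (hπ : ∀ x, π (Ideal.Quotient.mk _ x) = toA I φ x) :
    IsSFitt ℤ[G] ℚ[G] 1 (A I φ) (1 / Submodule.span ℤ[G] {algebraMap ℤ[G] ℚ[G] g} *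
      fracFitting ℤ[G] ℚ[G] (ℤ[G] ⧸ Ideal.span {g, intNorm I})) := by
  obtain ⟨τ, hτ⟩ := IsCyclic.exists_monoid_generator (α := I)
  let t : ℤ[G] := MonoidAlgebra.single (τ : G) 1 - 1
  have ht : t ∈ augIdeal I := Ideal.subset_span ⟨τ, rfl⟩
  have hdvd : ∀ σ : I, t ∣ MonoidAlgebra.single (σ : G) 1 - 1 := by
    intro σ
    obtain ⟨k, rfl⟩ := hτ σ
    have h := sub_dvd_pow_sub_pow (MonoidAlgebra.single (τ : G) 1 : ℤ[G]) 1 k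
    rwa [MonoidAlgebra.single_pow, one_pow, one_pow] at h
  have haug : ∀ x ∈ augIdeal I, t ∣ x := by
    intro x hx
    have : augIdeal I ≤ Ideal.span {t} := Ideal.span_le.2 <| by
      rintro _ ⟨σ, rfl⟩
      exact Ideal.mem_span_singleton.2 (hdvd σ)
    exact Ideal.mem_span_singleton.1 (this hx)
  have hgnz := mem_nonZeroDivisors_of_mul_eq_natCast hN hgw
  have hker : ∀ x, t * x ∈ Ideal.span {g} ↔ x ∈ Ideal.span {g, intNorm I} := by
    intro x
    constructor
    · intro hx
      obtain ⟨y, hy⟩ := Ideal.mem_span_singleton.1 hx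
      obtain ⟨z, rfl⟩ := haug y
        (mem_augIdeal_of_mul_mem hg (hy ▸ Ideal.mul_mem_right _ _ ht))
      obtain ⟨v, hv⟩ := exists_eq_intNorm_mul I (x := x - g * z) fun σ => by
        obtain ⟨r, hr⟩ := hdvd σ
        have h0 : t * (x - g * z) = 0 := by rw [mul_sub, hy]; ring
        rw [hr, mul_right_comm, h0, zero_mul]
      exact Ideal.mem_span_pair.2 ⟨z, v, by rw [mul_comm v, ← hv]; ring⟩
    · intro hx
      obtain ⟨a, b, rfl⟩ := Ideal.mem_span_pair.1 hx
      have h1 : intNorm I * t = 0 := (intNorm_mul_eq_zero_iff I).2 ht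
      refine Ideal.mem_span_singleton.2 ⟨t * a, ?_⟩
      linear_combination b * h1
  obtain ⟨i, hi⟩ := exists_comp_eq_of_ker_le (Ideal.span {g, intNorm I}).mkQ_surjective
    ((Ideal.span {g}).mkQ ∘ₗ LinearMap.mulLeft ℤ[G] t) fun x hx =>
      (Submodule.Quotient.mk_eq_zero _).2
        ((hker x).2 ((Submodule.Quotient.mk_eq_zero _).1 hx))
  have hi' : ∀ x : ℤ[G], i (Submodule.Quotient.mk x) = Submodule.Quotient.mk (t * x) :=
    fun x => LinearMap.congr_fun hi x
  refine isSFitt_of_exact hN hgw (i := i) (π := π) ?_ ?_ hπs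
  · rw [injective_iff_map_eq_zero]
    intro a ha
    obtain ⟨x, rfl⟩ := Submodule.mkQ_surjective _ a
    rw [Submodule.mkQ_apply, hi', Submodule.Quotient.mk_eq_zero] at ha
    exact (Submodule.Quotient.mk_eq_zero _).2 ((hker x).1 ha)
  · intro y
    obtain ⟨y, rfl⟩ := Ideal.Quotient.mk_surjective y
    rw [hπ, toA_eq_zero_iff hg]
    constructor
    · rintro ⟨z, hz⟩
      obtain ⟨x, hx⟩ := haug _ hz
      refine ⟨Submodule.Quotient.mk x, ?_⟩
      rw [hi', ← hx]
      exact (Submodule.Quotient.eq _).2 (Ideal.mem_span_singleton.2 ⟨-z, by ring⟩)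
    · rintro ⟨a, ha⟩
      obtain ⟨x, rfl⟩ := Submodule.mkQ_surjective _ a
      rw [Submodule.mkQ_apply, hi'] at ha
      obtain ⟨z, hz⟩ := Ideal.mem_span_singleton.1 ((Submodule.Quotient.eq _).1 ha)
      refine ⟨-z, ?_⟩
      have : y - g * -z = t * x := by rw [mul_neg, ← hz]; ring
      rw [this]
      exact Ideal.mul_mem_right _ _ ht

theorem isUnit_algebraMap_gElt (φ : G ⧸ I) :
    IsUnit (algebraMap ℤ[G ⧸ I] ℚ[G ⧸ I] (gElt I φ)) := by
  obtain ⟨w, N, hN, hw⟩ := exists_gElt_mul_eq_natCast I φ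
  exact isUnit_algebraMap_of_mul_eq_natCast hN hw

/-- The fractional ideal `g⁻¹ (g, ν_I)` is `(1, ν_I g⁻¹)`. -/
theorem one_div_mul_fracFitting_quotient (hN : N ≠ 0) (hgw : g * w = N)
    (hg : projHom I g = gElt I φ) :
    1 / Submodule.span ℤ[G] {algebraMap ℤ[G] ℚ[G] g} *
      fracFitting ℤ[G] ℚ[G] (ℤ[G] ⧸ Ideal.span {g, intNorm I}) =
    Submodule.span ℤ[G]
      {1, normMul I (Ring.inverse (algebraMap ℤ[G ⧸ I] ℚ[G ⧸ I] (gElt I φ)))} := by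
  have hu := isUnit_algebraMap_of_mul_eq_natCast hN hgw
  obtain ⟨y, hy⟩ := hu.exists_right_inv
  have hinv : Ring.inverse (algebraMap ℤ[G ⧸ I] ℚ[G ⧸ I] (gElt I φ)) =
      MonoidAlgebra.mapDomainRingHom ℚ (QuotientGroup.mk' I) y := by
    refine (isUnit_algebraMap_gElt φ).mul_left_cancel ?_
    rw [Ring.mul_inverse_cancel _ (isUnit_algebraMap_gElt φ), ← hg, algebraMap_projHom, ← map_mul,
      hy, map_one]
  rw [hinv, normMul_map, fracFitting_quotient, IsLocalization.coeSubmodule_span, Set.image_pair,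
    algebraMap_intNorm]
  have hus := isUnit_span_singleton (R := ℤ[G]) _ hu
  refine hus.mul_right_cancel ?_
  rw [mul_right_comm, one_div_mul_cancel_of_isUnit _ hus, one_mul, Submodule.span_mul_span,
    Set.mul_singleton, Set.image_pair, one_mul, mul_assoc, mul_comm y, hy, mul_one]

end Computation

end ShiftedFitting

open ShiftedFitting in
theorem mainTheorem5 {G : Type u} [CommGroup G] [Finite G]
    (I D : Subgroup G) (hID : I ≤ D)
    (φ : G ⧸ I) (hφ : Subgroup.zpowers φ = D.map (QuotientGroup.mk' I)) :
    -- the two shifts are well defined: every admissible sequence computes them, and one exists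
    (∀ J, IsSFitt (MonoidAlgebra ℤ G) (MonoidAlgebra ℚ G) 1 (A I φ) J ↔
      J = SFitt (MonoidAlgebra ℤ G) (MonoidAlgebra ℚ G) 1 (A I φ)) ∧
    (∀ J, IsSFittNeg (MonoidAlgebra ℤ G) (MonoidAlgebra ℚ G) 1 (A I φ) J ↔
      J = SFittNeg (MonoidAlgebra ℤ G) (MonoidAlgebra ℚ G) 1 (A I φ)) ∧
    SFitt (MonoidAlgebra ℤ G) (MonoidAlgebra ℚ G) 1 (A I φ) ≤
      SFittNeg (MonoidAlgebra ℤ G) (MonoidAlgebra ℚ G) 1 (A I φ) ∧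
    IsUnit (algebraMap (MonoidAlgebra ℤ (G ⧸ I)) (MonoidAlgebra ℚ (G ⧸ I)) (gElt I φ)) ∧
    SFittNeg (MonoidAlgebra ℤ G) (MonoidAlgebra ℚ G) 1 (A I φ) =
      Submodule.span (MonoidAlgebra ℤ G)
        {1, normMul I (Ring.inverse
          (algebraMap (MonoidAlgebra ℤ (G ⧸ I)) (MonoidAlgebra ℚ (G ⧸ I)) (gElt I φ)))} ∧
    (IsCyclic I →
      SFitt (MonoidAlgebra ℤ G) (MonoidAlgebra ℚ G) 1 (A I φ) =
        SFittNeg (MonoidAlgebra ℤ G) (MonoidAlgebra ℚ G) 1 (A I φ)) := by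
  obtain ⟨g, w, N, hN, hgw, hg⟩ := exists_lift_gElt I φ
  obtain ⟨π, hπs, hπ⟩ := exists_proj_A hg
  have hpos := isSFitt_A hN hgw hπs
  have hneg := isSFittNeg_A hN hgw hg
  have hpos_eq := (isSFitt_iff hpos _).1 hpos
  have hneg_eq := (isSFittNeg_iff hneg _).1 hneg
  refine ⟨isSFitt_iff hpos, isSFittNeg_iff hneg, ?_, isUnit_algebraMap_gElt φ, ?_, fun _ => ?_⟩
  · rw [← hpos_eq, ← hneg_eq, fracFitting_quotient]
    gcongr
    exact IsLocalization.coeSubmodule_mono _ (fittingIdeal_ker_le hg hπ)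
  · rw [← hneg_eq, one_div_mul_fracFitting_quotient hN hgw hg]
  · rw [← hneg_eq]
    exact ((isSFitt_iff hpos _).1 (isSFitt_A_of_isCyclic hN hgw hg hπs hπ)).symm
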